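/- **Theorem 3.** Let $\alpha>0$, let $n$ be an integer with $n>\max(3,\,1+1/\alpha)$, let $X_1,\dots,X_n$ be i.i.d. random variables with the gamma density $\Gamma(\alpha)^{-1}e^{-x}x^{\alpha-1}$ $(x>0)$, and let $$U_n^2=\Big(\sum_{i=1}^n X_i\Big)^{-2}\sum_{i=1}^n X_i^2 .$$ Let $D_{-\alpha}$ denote the parabolic cylinder function, i.e. the entire function $$D_{-\alpha}(z)=\sqrt{\pi}\,e^{-z^2/4}\left(\frac{2^{-\alpha/2}}{\Gamma((\alpha+1)/2)}\,M\!\Big(\frac{\alpha}{2},\frac12,\frac{z^2}{2}\Big)-\frac{2^{(1-\alpha)/2}}{\Gamma(\alpha/2)}\,z\,M\!\Big(\frac{\alpha+1}{2},\frac32,\frac{z^2}{2}\Big)\right),\qquad M(a,b,z)=\sum_{k\ge0}\frac{(a)_k}{(b)_k}\frac{z^k}{k!},$$ where $(c)_k=c(c+1)\cdots(c+k-1)$. For $s\in\mathbb R$, $t>0$ put (principal powers) $$\psi(s,t)=\Big(\frac{i}{2t}\Big)^{\alpha/2}\exp\Big(\frac{i(1-is)^2}{8t}\Big)\,D_{-\alpha}\Big(\sqrt{i}\,\frac{1-is}{\sqrt{2t}}\Big),\qquad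 t_k=\frac{k\pi}{\alpha^2 n(n-1)},$$ and for $k\ge1$, $0\le x\le 1-\frac1n$, $$a_k(s)=a_k(s;x)=\Im\Big\{\psi(s,t_k)^n\exp\Big(-i\alpha n s-\frac{ik\pi}{n-1}\Big)\Big\}\;\frac{1-\cos\big((1-n^{-1})^{-1}k\pi x\big)}{k}.$$ (i) $\psi$ is the joint characteristic function of $(X,X^2)$: $E\,e^{isX_j+itX_j^2}=\psi(s,t)$ for all $j$, all $s\in\mathbb R$ and all $t>0$. (ii) For $0\le x\le 1-\frac1n$ the finite sums $\sum_{k=1}^K a_k$ are integrable over $\mathbb R$, the limit below exists, and $$P\{U_n^2-n^{-1}\le x\}=\frac{\Gamma(\alpha n+1)}{\pi^2(\alpha n/e)^{\alpha n}}\;\lim_{K\to\infty}\int_{-\infty}^{\infty}\sum_{k=1}^K a_k(s)\,ds .$$ (iii) If moreover $\lfloor n/2\rfloor>\max\big(2,\,1+\frac1{2\alpha},\,\frac3{2\alpha}\big)$, then the limit may be taken under the integral: for $0\le x\le 1-\frac1n$ the series $\sum_{k\ge1}a_k(s)$ converges absolutely for every $s$, its sum is integrable over $\mathbb R$, $\lim_{K\to\infty}\int_{-\infty}^{\infty}\sum_{k=1}^K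 a_k(s)\,ds=\int_{-\infty}^\infty\sum_{k=1}^\infty a_k(s)\,ds$, and hence $$P\{U_n^2-n^{-1}\le x\}=\frac{\Gamma(\alpha n+1)}{\pi^2(\alpha n/e)^{\alpha n}}\int_{-\infty}^{\infty}\sum_{k=1}^\infty a_k(s)\,ds .$$ (iv) In particular, for $\alpha=1$ (Greenwood's statistic, in its representation through standard exponential variables), $n\ge6$ and $0\le x\le 1-\frac1n$, with $t_k=k\pi/(n(n-1))$, $$P\{U_n^2-n^{-1}\le x\}=\frac{n!}{\pi^2(n/e)^n}\int_{-\infty}^{\infty}\sum_{k=1}^\infty\Im\left\{\left(\Big(\frac{i}{2t_k}\Big)^{1/2}D_{-1}\Big(\sqrt i\,\frac{1-is}{\sqrt{2t_k}}\Big)\exp\Big(i\Big(\frac{(1-is)^2}{8t_k}-t_k-s\Big)\Big)\right)^{\!n}\right\}\frac{1-\cos\big((1-n^{-1})^{-1}k\pi x\big)}{k}\,ds,$$ where the series converges absolutely for every $s$ and its sum is integrable over $\mathbb R$. -/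

import Mathlib

open MeasureTheory ProbabilityTheory Filter Topology Complex

noncomputable section

/-- Kummer's confluent hypergeometric function `M(a, b, z) = ∑ₖ (a)ₖ / (b)ₖ * zᵏ / k!`. -/
def kummerM (a b z : ℂ) : ℂ :=
  ∑' k : ℕ, (ascPochhammer ℂ k).eval a / (ascPochhammer ℂ k).eval b * (z ^ k / (k.factorial : ℂ))

/-- The parabolic cylinder function `D_{-α}(z) = U(α - 1/2, z)`, an entire function of `z`: the
combination of the even solution `exp (-z²/4) M(α/2, 1/2, z²/2)` and the odd solution
`z exp (-z²/4) M((α+1)/2, 3/2, z²/2)` of `w'' = (z²/4 + α - 1/2) w` with initial values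
`w(0) = √π 2^(-α/2) / Γ((α+1)/2)` and `w'(0) = -√π 2^((1-α)/2) / Γ(α/2)`. -/
def parabolicCylinderD (α : ℝ) (z : ℂ) : ℂ :=
  ((√Real.pi * (2 : ℝ) ^ (-α / 2) / Real.Gamma ((α + 1) / 2) : ℝ) : ℂ)
      * (exp (-z ^ 2 / 4) * kummerM ((α : ℂ) / 2) (1 / 2) (z ^ 2 / 2))
    - ((√Real.pi * (2 : ℝ) ^ ((1 - α) / 2) / Real.Gamma (α / 2) : ℝ) : ℂ)
      * (z * exp (-z ^ 2 / 4) * kummerM (((α : ℂ) + 1) / 2) (3 / 2) (z ^ 2 / 2))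

/-- `ψ(s, t) = (i/(2t))^(α/2) exp (i(1-is)²/(8t)) D_{-α}(√i (1-is)/√(2t))`, with principal
powers. -/
def gammaPsi (α s t : ℝ) : ℂ :=
  (I / (2 * (t : ℂ))) ^ ((α : ℂ) / 2)
    * exp (I * (1 - I * (s : ℂ)) ^ 2 / (8 * (t : ℂ)))
    * parabolicCylinderD α (I ^ (1 / 2 : ℂ) * (1 - I * (s : ℂ)) / ((√(2 * t) : ℝ) : ℂ))

/-- `U_n² = (∑ Xᵢ)⁻² ∑ Xᵢ²`. -/
def squareSumRatio {Ω : Type*} {n : ℕ} (X : Fin n → Ω → ℝ) (ω : Ω) : ℝ :=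
  (∑ i, X i ω ^ 2) / (∑ i, X i ω) ^ 2

/-- `t_k = kπ / (α² n (n-1))`. -/
def fourierNode (α : ℝ) (n k : ℕ) : ℝ :=
  k * Real.pi / (α ^ 2 * n * ((n : ℝ) - 1))

/-- The `k`-th term of the integrand, as a function of `s`:
`Im {ψ(s, t_k)ⁿ exp (-iαns - ikπ/(n-1))} (1 - cos (kπx/(1-1/n))) / k`. -/
def cdfTerm (α : ℝ) (n : ℕ) (x : ℝ) (k : ℕ) (s : ℝ) : ℝ :=
  (gammaPsi α s (fourierNode α n k) ^ n
      * exp (-I * α * n * s - I * (k * Real.pi / ((n : ℂ) - 1)))).im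
    * (1 - Real.cos (k * Real.pi * x / (1 - 1 / (n : ℝ)))) / k

/-- The constant `Γ(αn+1) / (π² (αn/e)^(αn))`. -/
def cdfConst (α : ℝ) (n : ℕ) : ℝ :=
  Real.Gamma (α * n + 1) / (Real.pi ^ 2 * (α * n / Real.exp 1) ^ (α * n))

/-- The `k`-th term for `α = 1` in explicit form, with `t_k = kπ / (n(n-1))`:
`Im {((i/(2t_k))^(1/2) D_{-1}(√i (1-is)/√(2t_k)) exp (i((1-is)²/(8t_k) - t_k - s)))ⁿ}
  (1 - cos (kπx/(1-1/n))) / k`. -/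
def greenwoodTerm (n : ℕ) (x : ℝ) (k : ℕ) (s : ℝ) : ℝ :=
  let t : ℝ := k * Real.pi / (n * ((n : ℝ) - 1))
  (((I / (2 * (t : ℂ))) ^ (1 / 2 : ℂ)
      * parabolicCylinderD 1 (I ^ (1 / 2 : ℂ) * (1 - I * (s : ℂ)) / ((√(2 * t) : ℝ) : ℂ))
      * exp (I * ((1 - I * (s : ℂ)) ^ 2 / (8 * (t : ℂ)) - t - s))) ^ n).im
    * (1 - Real.cos (k * Real.pi * x / (1 - 1 / (n : ℝ)))) / k

end

/-! Write S = ∑ Xᵢ, R = ∑ Xᵢ² / S² and m = αn. For gamma variables S is independent of the scale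
invariant ratio R (`map_sum_sumSqRatio`), and ∑ Xᵢ² = S²R. So, with f the density of S, ψ(s,t)ⁿ is
in the variable s the Fourier transform of y ↦ f(y) E exp(ity²R), and inversion at the point y = m
gives ∫ ψ(s,t)ⁿ exp(-ims) ds = 2π f(m) E exp(itm²R) (`integral_gammaPsi_pow_mul_cexp`).

The nodes satisfy t_k m² = kπ/(1 - 1/n), and the phase -kπ/(n-1) recentres R at 1/n, so the
imaginary part of the k-th integral is 2π f(m) E sin(kθ), where θ = π(R - 1/n)/(1 - 1/n) lies in [0,
π]. The series ∑ sin(kθ)(1 - cos ky)/k is a combination of sawtooth series; its partial sums are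
bounded and tend to π/2 for θ < y and to 0 for θ > y. Since R has no atoms, dominated convergence
under the law of R turns the limit into (π/2) P{θ ≤ y}, and `cdfConst` is the reciprocal of 2π f(m)
· π/2.

The closed form of ψ comes from expanding exp(-ax) in ∫ x^(α-1) exp(-ax - τx²) dx: the even and odd
terms are the two Kummer series of the parabolic cylinder function. This is valid for Re τ > 0 and
extends to τ = -it by letting Re τ decrease to 0.

The analytic input is decay of ψ. Cutting the defining integral near the origin and applying first
and second derivative tests gives, for every 0 < β < 1 with β ≤ α, both |ψ| ≤ C t^(-β/2) and |ψ| ≤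
C(|s|^(-β) + exp(-|s|/(16t))). If nβ > 1, then ψⁿ is integrable in s; if nβ > 3, the two bounds
combine to t^(-1/9)(1+|s|)^(-10/9), which makes the terms of the series jointly summable and
integrable, so that sum and integral may be exchanged. -/

/-! ### Gamma law and Gamma integrals with complex rate -/

/-- The density of the gamma distribution of rate one on the positive half line. -/
lemma gammaMeasure_one_eq_withDensity (b : ℝ) :
    gammaMeasure b 1 = (volume.restrict (Set.Ioi (0 : ℝ))).withDensity
      (fun x => ENNReal.ofReal (x ^ (b - 1) * Real.exp (-x) / Real.Gamma b)) := by
  rw [← withDensity_indicator measurableSet_Ioi, gammaMeasure]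
  refine withDensity_congr_ae ?_
  filter_upwards [Measure.ae_ne volume (0 : ℝ)] with x hx
  rcases lt_or_gt_of_ne hx with h | h
  · rw [gammaPDF_of_neg h, Set.indicator_of_notMem (by simp [h.le])]
  · rw [gammaPDF_of_nonneg h.le, Set.indicator_of_mem (by simpa using h)]
    congr 1
    simp
    ring

lemma gammaDensity_nonneg {b : ℝ} (hb : 0 < b) {x : ℝ} (hx : 0 < x) :
    0 ≤ x ^ (b - 1) * Real.exp (-x) / Real.Gamma b := by
  have := Real.Gamma_pos_of_pos hb
  positivity

lemma integral_gammaMeasure_one {E : Type*} [NormedAddCommGroup E] [NormedSpace ℝ E]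
    {b : ℝ} (hb : 0 < b) (f : ℝ → E) :
    ∫ x, f x ∂(gammaMeasure b 1) =
      ∫ x in Set.Ioi (0 : ℝ), (x ^ (b - 1) * Real.exp (-x) / Real.Gamma b) • f x := by
  rw [gammaMeasure_one_eq_withDensity,
    integral_withDensity_eq_integral_toReal_smul (by fun_prop) (by simp)]
  refine setIntegral_congr_fun measurableSet_Ioi fun x hx => ?_
  rw [ENNReal.toReal_ofReal (gammaDensity_nonneg hb hx)]

lemma integrable_gammaMeasure_one_iff {E : Type*} [NormedAddCommGroup E] [NormedSpace ℝ E]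
    {b : ℝ} (hb : 0 < b) (f : ℝ → E) :
    Integrable f (gammaMeasure b 1) ↔
      IntegrableOn (fun x => (x ^ (b - 1) * Real.exp (-x) / Real.Gamma b) • f x)
        (Set.Ioi (0 : ℝ)) := by
  rw [gammaMeasure_one_eq_withDensity,
    integrable_withDensity_iff_integrable_smul' (by fun_prop) (by simp), IntegrableOn]
  refine integrable_congr ?_
  filter_upwards [ae_restrict_mem measurableSet_Ioi] with x hx
  rw [ENNReal.toReal_ofReal (gammaDensity_nonneg hb hx)]

lemma integrableOn_rpow_mul_exp_neg_mul {b r : ℝ} (hb : 0 < b) (hr : 0 < r) :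
    IntegrableOn (fun x : ℝ => x ^ (b - 1) * Real.exp (-(r * x))) (Set.Ioi 0) := by
  have := integrableOn_rpow_mul_exp_neg_mul_rpow (p := 1) (s := b - 1) (b := r)
    (by linarith) one_pos hr
  simpa using this

/-- Provides the half plane Re z < 1 on which the complex moment generating function is analytic. -/
lemma Iio_one_subset_integrableExpSet {b : ℝ} (hb : 0 < b) :
    Set.Iio 1 ⊆ integrableExpSet id (gammaMeasure b 1) := by
  intro t ht
  change Integrable _ _
  rw [integrable_gammaMeasure_one_iff hb]
  refine IntegrableOn.congr_fun (Integrable.div_const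
    (integrableOn_rpow_mul_exp_neg_mul hb (sub_pos.2 ht)) (Real.Gamma b)) (fun x hx => ?_) measurableSet_Ioi
  simp only [smul_eq_mul, id]
  rw [div_mul_eq_mul_div, mul_assoc, ← Real.exp_add]
  congr 3
  ring

/-- The Gamma integral with a complex rate. -/
lemma integral_rpow_mul_cexp_neg_mul_Ioi {b : ℝ} (hb : 0 < b) {τ : ℂ} (hτ : 0 < τ.re) :
    ∫ x in Set.Ioi (0 : ℝ), ((x ^ (b - 1) : ℝ) : ℂ) * exp (-τ * x) =
      (Real.Gamma b : ℂ) * τ ^ (-(b : ℂ)) := by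
  have hG := (Real.Gamma_pos_of_pos hb).ne'
  have hGc : (Real.Gamma b : ℂ) ≠ 0 := by exact_mod_cast hG
  have key : ∀ z : ℂ, complexMGF id (gammaMeasure b 1) z =
      (Real.Gamma b : ℂ)⁻¹ * ∫ x in Set.Ioi (0 : ℝ), ((x ^ (b - 1) : ℝ) : ℂ) *
        exp (-(1 - z) * x) := by
    intro z
    rw [complexMGF, integral_gammaMeasure_one hb, ← integral_const_mul]
    refine setIntegral_congr_fun measurableSet_Ioi fun x hx => ?_
    simp only [id, real_smul]
    rw [show -(1 - z) * (x : ℂ) = ((-x : ℝ) : ℂ) + z * x by push_cast; ring, Complex.exp_add]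
    push_cast
    field_simp
  have hopen : IsOpen {z : ℂ | z.re < 1} := isOpen_lt Complex.continuous_re continuous_const
  have hsub : {z : ℂ | z.re < 1} ⊆
      {z : ℂ | z.re ∈ interior (integrableExpSet id (gammaMeasure b 1))} := fun z hz =>
    interior_mono (Iio_one_subset_integrableExpSet hb) (by rw [isOpen_Iio.interior_eq]; exact hz)
  have hf : AnalyticOnNhd ℂ (complexMGF id (gammaMeasure b 1)) {z : ℂ | z.re < 1} :=
    analyticOnNhd_complexMGF.mono hsub
  have hg : AnalyticOnNhd ℂ (fun z : ℂ => (1 - z) ^ (-(b : ℂ))) {z : ℂ | z.re < 1} := by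
    refine DifferentiableOn.analyticOnNhd (fun z hz => ?_) hopen
    refine DifferentiableAt.differentiableWithinAt ?_
    refine DifferentiableAt.cpow (by fun_prop) (by fun_prop) ?_
    left
    simpa using hz
  have hreal : ∀ t : ℝ, t < 1 → complexMGF id (gammaMeasure b 1) (t : ℂ) =
      (1 - (t : ℂ)) ^ (-(b : ℂ)) := by
    intro t ht
    have h1 : 0 < 1 - t := sub_pos.2 ht
    have h2 := integral_cpow_mul_exp_neg_mul_Ioi (a := (b : ℂ)) (r := 1 - t) (by simpa) h1
    rw [key, inv_mul_eq_iff_eq_mul₀ hGc, ← Complex.Gamma_ofReal]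
    push_cast at h2
    rw [mul_comm, Complex.cpow_neg, ← Complex.inv_cpow, ← one_div, ← h2]
    · refine setIntegral_congr_fun measurableSet_Ioi fun x hx => ?_
      rw [Complex.ofReal_cpow (le_of_lt hx)]
      push_cast
      ring_nf
    · rw [show (1 - (t : ℂ)) = ((1 - t : ℝ) : ℂ) by push_cast; rfl, Complex.arg_ofReal_of_nonneg h1.le]
      exact Real.pi_pos.ne
  have hconn : IsPreconnected {z : ℂ | z.re < 1} := (convex_halfSpace_re_lt 1).isPreconnected
  -- Identity theorem: both functions agree at the real points -1/(m+1), which accumulate at 0.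
  have heq := hf.eqOn_of_preconnected_of_frequently_eq hg hconn (z₀ := 0) (by simp) (by
    have ht : Tendsto (fun m : ℕ => ((-(1 / ((m : ℝ) + 1)) : ℝ) : ℂ)) atTop (𝓝[≠] 0) := by
      rw [tendsto_nhdsWithin_iff]
      constructor
      · have := (tendsto_one_div_add_atTop_nhds_zero_nat (𝕜 := ℝ)).neg
        rw [neg_zero] at this
        exact_mod_cast (Complex.continuous_ofReal.tendsto 0).comp this
      · refine Eventually.of_forall fun m => ?_
        have : (-(1 / ((m : ℝ) + 1))) ≠ 0 := neg_ne_zero.2 (by positivity)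
        exact Complex.ofReal_ne_zero.2 this
    refine ht.frequently (Frequently.of_forall fun m => hreal _ ?_)
    have : 0 < 1 / ((m : ℝ) + 1) := by positivity
    linarith)
  have := heq (x := 1 - τ) (by simpa using hτ)
  simp only [key, sub_sub_cancel] at this
  rw [inv_mul_eq_iff_eq_mul₀ hGc] at this
  exact this

/-- Moments of a Gaussian with complex parameter on the half line. -/
lemma integral_rpow_mul_cexp_neg_mul_sq_Ioi {b : ℝ} (hb : 0 < b) {τ : ℂ} (hτ : 0 < τ.re) :
    ∫ x in Set.Ioi (0 : ℝ), ((x ^ (b - 1) : ℝ) : ℂ) * exp (-τ * x ^ 2) =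
      (Real.Gamma (b / 2) : ℂ) * τ ^ (-((b : ℂ) / 2)) / 2 := by
  have h := integral_rpow_mul_cexp_neg_mul_Ioi (half_pos hb) hτ
  -- Substitution of x² for the variable in the Gamma integral of shape b/2.
  rw [← integral_comp_rpow_Ioi_of_pos two_pos] at h
  push_cast at h
  rw [← h, eq_div_iff two_ne_zero, mul_comm, ← integral_const_mul]
  refine setIntegral_congr_fun measurableSet_Ioi fun x hx => ?_
  have hx : 0 < x := hx
  simp only [real_smul]
  have e : (x ^ (b - 1) : ℝ) = x ^ ((2:ℝ) - 1) * (x ^ (2 : ℝ)) ^ (b / 2 - 1) := by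
    rw [← Real.rpow_mul hx.le, ← Real.rpow_add hx]
    ring_nf
  rw [e, Real.rpow_two]
  push_cast
  ring

/-! ### Gaussian Laplace transform and Kummer functions -/

/-- The Laplace transform at `a` of `x ↦ x ^ (α - 1) exp (-τ x²)` on the positive half line. -/
noncomputable def gaussLaplace (α : ℝ) (a τ : ℂ) : ℂ :=
  ∫ x in Set.Ioi (0 : ℝ), ((x ^ (α - 1) : ℝ) : ℂ) * exp (-a * x - τ * x ^ 2)

lemma norm_gaussLaplace_integrand {α : ℝ} {x : ℝ} (hx : 0 < x) (a τ : ℂ) :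
    ‖((x ^ (α - 1) : ℝ) : ℂ) * exp (-a * x - τ * x ^ 2)‖ =
      x ^ (α - 1) * Real.exp (-a.re * x - τ.re * x ^ 2) := by
  rw [norm_mul, norm_real, Complex.norm_exp, Real.norm_of_nonneg (by positivity)]
  congr 2
  simp [← Complex.ofReal_pow]

/-- Completing the square; the Gaussian absorbs any linear exponent and still leaves exp(-x). -/
lemma exp_linear_sub_sq_le {c r x : ℝ} (hr : 0 < r) :
    Real.exp (c * x - r * x ^ 2) ≤ Real.exp ((c + 1) ^ 2 / (4 * r)) * Real.exp (-x) := by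
  rw [← Real.exp_add, Real.exp_le_exp]
  have : (c + 1) ^ 2 / (4 * r) + -x - (c * x - r * x ^ 2) = (2 * r * x - (c + 1)) ^ 2 / (4 * r) := by
    field_simp
    ring
  have h2 : 0 ≤ (2 * r * x - (c + 1)) ^ 2 / (4 * r) := by positivity
  linarith

lemma integrableOn_rpow_mul_exp_linear_sub_sq {α c r : ℝ} (hα : 0 < α) (hr : 0 < r) :
    IntegrableOn (fun x : ℝ => x ^ (α - 1) * Real.exp (c * x - r * x ^ 2)) (Set.Ioi 0) := by
  have h := (integrableOn_rpow_mul_exp_neg_mul hα one_pos).const_mul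
    (Real.exp ((c + 1) ^ 2 / (4 * r)))
  refine Integrable.mono' h (by fun_prop) ?_
  filter_upwards [ae_restrict_mem measurableSet_Ioi] with x hx
  have hx : 0 < x := hx
  rw [Real.norm_of_nonneg (by positivity)]
  calc _ ≤ x ^ (α - 1) * (Real.exp ((c + 1) ^ 2 / (4 * r)) * Real.exp (-x)) := by
        gcongr
        exact exp_linear_sub_sq_le hr
    _ = _ := by rw [one_mul]; ring

/-- Expand exp(-ax) in its power series and integrate term by term; the series of absolute values
sums to exp(‖a‖x), which the Gaussian factor dominates. -/
lemma hasSum_gaussLaplace {α : ℝ} (hα : 0 < α) (a : ℂ) {τ : ℂ} (hτ : 0 < τ.re) :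
    HasSum (fun k : ℕ => (-a) ^ k / (k.factorial : ℂ) *
      ((Real.Gamma ((α + k) / 2) : ℂ) * τ ^ (-((α + k : ℂ) / 2)) / 2)) (gaussLaplace α a τ) := by
  have hsumexp : ∀ z : ℂ, HasSum (fun k : ℕ => z ^ k / (k.factorial : ℂ)) (exp z) := fun z => by
    rw [Complex.exp_eq_exp_ℂ]
    exact NormedSpace.expSeries_div_hasSum_exp z
  have hsumexpr : ∀ z : ℝ, HasSum (fun k : ℕ => z ^ k / (k.factorial : ℝ)) (Real.exp z) := fun z => by
    rw [Real.exp_eq_exp_ℝ]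
    exact NormedSpace.expSeries_div_hasSum_exp z
  have hb : ∀ x : ℝ, HasSum (fun k : ℕ => x ^ (α - 1) * Real.exp (-τ.re * x ^ 2) *
      ((‖a‖ * x) ^ k / (k.factorial : ℝ)))
      (x ^ (α - 1) * Real.exp (-τ.re * x ^ 2) * Real.exp (‖a‖ * x)) := fun x =>
    (hsumexpr _).mul_left _
  have h := hasSum_integral_of_dominated_convergence (μ := volume.restrict (Set.Ioi (0 : ℝ)))
    (F := fun (k : ℕ) (x : ℝ) => ((x ^ (α - 1) : ℝ) : ℂ) * exp (-τ * x ^ 2) *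
      ((-a * x) ^ k / (k.factorial : ℂ)))
    (f := fun x => ((x ^ (α - 1) : ℝ) : ℂ) * exp (-a * x - τ * x ^ 2))
    (fun k x => x ^ (α - 1) * Real.exp (-τ.re * x ^ 2) * ((‖a‖ * x) ^ k / (k.factorial : ℝ)))
    (fun k => by fun_prop) ?_ ?_ ?_ ?_
  · rw [gaussLaplace]
    have e : ∀ f g : ℕ → ℂ, (∀ k, g k = f k) → ∀ {s}, HasSum f s → HasSum g s :=
      fun f g hfg s hs => (funext hfg : g = f) ▸ hs
    refine e _ _ (fun k => ?_) h
    have hbk : 0 < α + (k : ℝ) := by positivity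
    have := integral_rpow_mul_cexp_neg_mul_sq_Ioi hbk hτ
    push_cast at this
    rw [← this, ← integral_const_mul]
    refine setIntegral_congr_fun measurableSet_Ioi fun x hx => ?_
    have hx : 0 < x := hx
    rw [show α + k - 1 = (α - 1) + k by ring, Real.rpow_add hx, Real.rpow_natCast]
    push_cast
    rw [mul_pow]
    ring
  · intro k
    filter_upwards [ae_restrict_mem measurableSet_Ioi] with x hx
    have hx : 0 < x := hx
    rw [norm_mul, norm_mul, norm_real, Complex.norm_exp, Real.norm_of_nonneg (by positivity),
      norm_div, norm_pow, norm_mul, norm_neg, norm_real, Real.norm_of_nonneg hx.le,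
      Complex.norm_natCast]
    simp [← Complex.ofReal_pow]
  · exact ae_of_all _ fun x => (hb x).summable
  · simp_rw [fun x => (hb x).tsum_eq]
    refine (integrableOn_rpow_mul_exp_linear_sub_sq (c := ‖a‖) hα hτ).congr ?_
    refine ae_of_all _ fun x => ?_
    beta_reduce
    rw [mul_assoc, ← Real.exp_add]
    ring_nf
  · refine ae_of_all _ fun x => ?_
    have := (hsumexp (-a * x)).mul_left (((x ^ (α - 1) : ℝ) : ℂ) * exp (-τ * x ^ 2))
    rw [mul_assoc, ← Complex.exp_add] at this
    rwa [show -a * (x : ℂ) - τ * x ^ 2 = -τ * x ^ 2 + -a * x by ring]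

lemma Gamma_add_nat_eq_ascPochhammer {b : ℝ} (hb : 0 < b) (j : ℕ) :
    Real.Gamma (b + j) = (ascPochhammer ℝ j).eval b * Real.Gamma b := by
  induction j with
  | zero => simp
  | succ j ih =>
    rw [ascPochhammer_succ_eval, Nat.cast_succ, ← add_assoc, Real.Gamma_add_one (by positivity), ih]
    ring

lemma ofReal_ascPochhammer_eval (b : ℝ) (j : ℕ) :
    (((ascPochhammer ℝ j).eval b : ℝ) : ℂ) = (ascPochhammer ℂ j).eval (b : ℂ) := by
  rw [← ascPochhammer_map Complex.ofRealHom, Polynomial.eval_map]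
  exact (Polynomial.eval₂_at_apply Complex.ofRealHom b).symm

lemma factorial_two_mul_eq (j : ℕ) :
    ((2 * j).factorial : ℝ) = 4 ^ j * j.factorial * (ascPochhammer ℝ j).eval (1 / 2) := by
  induction j with
  | zero => simp
  | succ j ih =>
    rw [show 2 * (j + 1) = 2 * j + 1 + 1 by ring, Nat.factorial_succ, Nat.factorial_succ,
      ascPochhammer_succ_eval, Nat.factorial_succ]
    push_cast
    rw [ih]
    ring

lemma factorial_two_mul_add_one_eq (j : ℕ) :
    ((2 * j + 1).factorial : ℝ) = 4 ^ j * j.factorial * (ascPochhammer ℝ j).eval (3 / 2) := by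
  induction j with
  | zero => simp
  | succ j ih =>
    rw [show 2 * (j + 1) + 1 = 2 * j + 1 + 1 + 1 by ring, Nat.factorial_succ (2 * j + 1 + 1),
      Nat.factorial_succ (2 * j + 1), ascPochhammer_succ_eval, Nat.factorial_succ j]
    push_cast
    rw [ih]
    ring

/-- Matches the even coefficients of the series with those of M(·, 1/2, ·); the factor 4^j is what
turns y² into y²/4 in the argument. -/
lemma Gamma_add_nat_div_factorial_two_mul {b : ℝ} (hb : 0 < b) (j : ℕ) :
    (Real.Gamma (b + j) : ℂ) / ((2 * j).factorial : ℂ) =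
      (Real.Gamma b : ℂ) * ((ascPochhammer ℂ j).eval (b : ℂ) /
        (ascPochhammer ℂ j).eval (1 / 2 : ℂ)) / (4 ^ j * (j.factorial : ℂ)) := by
  have h : Real.Gamma (b + j) / ((2 * j).factorial : ℝ) =
      Real.Gamma b * ((ascPochhammer ℝ j).eval b /
        (ascPochhammer ℝ j).eval (1 / 2 : ℝ)) / (4 ^ j * (j.factorial : ℝ)) := by
    have h3 := ascPochhammer_pos (S := ℝ) j (1 / 2) (by norm_num)
    rw [Gamma_add_nat_eq_ascPochhammer hb, factorial_two_mul_eq]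
    field_simp
  have := congrArg (fun r : ℝ => (r : ℂ)) h
  push_cast [ofReal_ascPochhammer_eval] at this
  exact this

lemma Gamma_add_nat_div_factorial_two_mul_add_one {b : ℝ} (hb : 0 < b) (j : ℕ) :
    (Real.Gamma (b + j) : ℂ) / ((2 * j + 1).factorial : ℂ) =
      (Real.Gamma b : ℂ) * ((ascPochhammer ℂ j).eval (b : ℂ) /
        (ascPochhammer ℂ j).eval (3 / 2 : ℂ)) / (4 ^ j * (j.factorial : ℂ)) := by
  have h : Real.Gamma (b + j) / ((2 * j + 1).factorial : ℝ) =
      Real.Gamma b * ((ascPochhammer ℝ j).eval b /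
        (ascPochhammer ℝ j).eval (3 / 2 : ℝ)) / (4 ^ j * (j.factorial : ℝ)) := by
    have h3 := ascPochhammer_pos (S := ℝ) j (3 / 2) (by norm_num)
    rw [Gamma_add_nat_eq_ascPochhammer hb, factorial_two_mul_add_one_eq]
    field_simp
  have := congrArg (fun r : ℝ => (r : ℂ)) h
  push_cast [ofReal_ascPochhammer_eval] at this
  exact this

lemma cpow_neg_add_nat {τ : ℂ} (hτ : τ ≠ 0) (c : ℂ) (j : ℕ) :
    τ ^ (-(c + j)) = τ ^ (-c) * (τ ^ (-(1 / 2 : ℂ))) ^ (2 * j) := by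
  rw [← Complex.cpow_nat_mul, neg_add, Complex.cpow_add _ _ hτ]
  push_cast
  ring_nf

/-- The Laplace transform in terms of Kummer functions. -/
lemma gaussLaplace_eq_kummerM {α : ℝ} (hα : 0 < α) (a : ℂ) {τ : ℂ} (hτ : 0 < τ.re) :
    gaussLaplace α a τ = τ ^ (-((α : ℂ) / 2)) / 2 *
      ((Real.Gamma (α / 2) : ℂ) * kummerM ((α : ℂ) / 2) (1 / 2) ((a * τ ^ (-(1 / 2 : ℂ))) ^ 2 / 4)
        - (a * τ ^ (-(1 / 2 : ℂ))) * (Real.Gamma ((α + 1) / 2) : ℂ) *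
          kummerM (((α : ℂ) + 1) / 2) (3 / 2) ((a * τ ^ (-(1 / 2 : ℂ))) ^ 2 / 4)) := by
  have hτ0 : τ ≠ 0 := by rintro rfl; simp at hτ
  have h := hasSum_gaussLaplace hα a hτ
  have hs := h.summable
  have i0 : Function.Injective (fun j : ℕ => 2 * j) := fun i j hij => by simpa using hij
  have i1 : Function.Injective (fun j : ℕ => 2 * j + 1) := fun i j hij => by simpa using hij
  set f : ℕ → ℂ := fun k => (-a) ^ k / (k.factorial : ℂ) *
      ((Real.Gamma ((α + k) / 2) : ℂ) * τ ^ (-((α + k : ℂ) / 2)) / 2) with hf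
  -- Even powers of a give the Kummer series with parameter 1/2, odd powers the one with 3/2.
  have heo := tsum_even_add_odd (f := f) (hs.comp_injective i0) (hs.comp_injective i1)
  rw [h.tsum_eq] at heo
  rw [← heo, mul_sub, sub_eq_add_neg, hf]
  generalize hw : τ ^ (-(1 / 2 : ℂ)) = w
  congr 1
  · rw [kummerM, ← tsum_mul_left, ← tsum_mul_left]
    refine tsum_congr fun j => ?_
    have h1 := Gamma_add_nat_div_factorial_two_mul (half_pos hα) j
    have e1 : ((α : ℂ) + (2 * j : ℕ)) / 2 = (α : ℂ) / 2 + j := by push_cast; ring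
    have e2 : (α + (2 * j : ℕ)) / 2 = α / 2 + j := by push_cast; ring
    push_cast at h1
    beta_reduce
    rw [e1, e2, cpow_neg_add_nat hτ0, hw, (even_two_mul j).neg_pow]
    calc _ = τ ^ (-((α : ℂ) / 2)) / 2 * (a * w) ^ (2 * j) *
          ((Real.Gamma (α / 2 + j) : ℂ) / ((2 * j).factorial : ℂ)) := by rw [mul_pow]; ring
      _ = _ := by rw [h1, div_pow, ← pow_mul, mul_comm 2 j]; ring
  · rw [kummerM, ← tsum_mul_left, ← mul_neg, ← tsum_neg, ← tsum_mul_left]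
    refine tsum_congr fun j => ?_
    have h1 := Gamma_add_nat_div_factorial_two_mul_add_one (show 0 < (α + 1) / 2 by positivity) j
    have e1 : ((α : ℂ) + (2 * j + 1 : ℕ)) / 2 = (α : ℂ) / 2 + 1 / 2 + j := by push_cast; ring
    have e2 : (α + (2 * j + 1 : ℕ)) / 2 = (α + 1) / 2 + j := by push_cast; ring
    push_cast at h1
    beta_reduce
    rw [e1, e2, cpow_neg_add_nat hτ0, hw, (odd_two_mul_add_one j).neg_pow, neg_add,
      Complex.cpow_add _ _ hτ0, hw]
    calc _ = -(τ ^ (-((α : ℂ) / 2)) / 2 * (a * w) * (a * w) ^ (2 * j) *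
          ((Real.Gamma ((α + 1) / 2 + j) : ℂ) / ((2 * j + 1).factorial : ℂ))) := by
            rw [mul_pow]; ring
      _ = _ := by rw [h1, div_pow, ← pow_mul, mul_comm 2 j]; ring

/-- Scaling by the complex number τ^(1/2), read off from the Kummer form on both sides, so no
contour has to be rotated. -/
lemma gaussLaplace_eq_cpow_mul {α : ℝ} (hα : 0 < α) (a : ℂ) {τ : ℂ} (hτ : 0 < τ.re) :
    gaussLaplace α a τ =
      τ ^ (-((α : ℂ) / 2)) * gaussLaplace α (a * τ ^ (-(1 / 2 : ℂ))) 1 := by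
  rw [gaussLaplace_eq_kummerM hα a hτ, gaussLaplace_eq_kummerM hα _ (by simp : 0 < (1 : ℂ).re)]
  simp only [Complex.one_cpow, mul_one]
  ring

lemma continuous_gaussLaplace_one {α : ℝ} (hα : 0 < α) :
    Continuous (fun a : ℂ => gaussLaplace α a 1) := by
  rw [continuous_iff_continuousAt]
  intro a₀
  refine continuousAt_of_dominated
    (bound := fun x => x ^ (α - 1) * Real.exp ((‖a₀‖ + 1) * x - 1 * x ^ 2))
    (Eventually.of_forall fun a => by fun_prop) ?_
    (integrableOn_rpow_mul_exp_linear_sub_sq hα one_pos) ?_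
  · filter_upwards [Metric.ball_mem_nhds a₀ one_pos] with a ha
    filter_upwards [ae_restrict_mem measurableSet_Ioi] with x hx
    have hx : 0 < x := hx
    rw [norm_gaussLaplace_integrand hx, Complex.one_re]
    have h1 : -a.re ≤ ‖a₀‖ + 1 := by
      have h2 := Complex.abs_re_le_norm a
      have h3 := norm_le_norm_add_norm_sub' a a₀
      rw [mem_ball_iff_norm] at ha
      linarith [neg_le_abs a.re]
    gcongr
  · exact ae_of_all _ fun x => by fun_prop

/-- For Re a > 0 the factor exp(-ax) alone dominates, so the transform is continuous up to the line
Re τ = 0 from the right. -/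
lemma tendsto_gaussLaplace {α : ℝ} (hα : 0 < α) {a : ℂ} (ha : 0 < a.re) (τ : ℂ) (hτ : 0 ≤ τ.re) :
    Tendsto (fun ε : ℝ => gaussLaplace α a (ε + τ)) (𝓝[>] 0) (𝓝 (gaussLaplace α a τ)) := by
  refine tendsto_integral_filter_of_dominated_convergence
    (fun x => x ^ (α - 1) * Real.exp (-(a.re * x)))
    (Eventually.of_forall fun ε => by fun_prop) ?_
    (integrableOn_rpow_mul_exp_neg_mul hα ha) ?_
  · filter_upwards [self_mem_nhdsWithin] with ε hε
    have hε : 0 < ε := hε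
    filter_upwards [ae_restrict_mem measurableSet_Ioi] with x hx
    have hx : 0 < x := hx
    rw [norm_gaussLaplace_integrand hx]
    gcongr
    have : 0 ≤ (ε + τ : ℂ).re := by simp; linarith
    nlinarith [mul_nonneg this (sq_nonneg x)]
  · refine ae_of_all _ fun x => ?_
    have h : Continuous fun ε : ℝ =>
        ((x ^ (α - 1) : ℝ) : ℂ) * exp (-a * x - ((ε : ℂ) + τ) * x ^ 2) := by fun_prop
    have h0 := h.tendsto 0
    simp only [Complex.ofReal_zero, zero_add] at h0
    exact h0.mono_left nhdsWithin_le_nhds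

/-- Both sides of the scaling identity are continuous under ε + τ → τ; the slit plane keeps the
principal powers continuous in the limit. -/
lemma gaussLaplace_eq_cpow_mul_of_re_nonneg {α : ℝ} (hα : 0 < α) {a : ℂ} (ha : 0 < a.re) {τ : ℂ}
    (hτ : 0 ≤ τ.re) (hτ' : τ ∈ slitPlane) :
    gaussLaplace α a τ =
      τ ^ (-((α : ℂ) / 2)) * gaussLaplace α (a * τ ^ (-(1 / 2 : ℂ))) 1 := by
  have h1 := tendsto_gaussLaplace hα ha τ hτ
  have hpow : ∀ c : ℂ, Tendsto (fun ε : ℝ => ((ε : ℂ) + τ) ^ c) (𝓝[>] 0) (𝓝 (τ ^ c)) := by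
    intro c
    have h : ContinuousAt (fun ε : ℝ => ((ε : ℂ) + τ) ^ c) 0 := by
      refine ContinuousAt.cpow (by fun_prop) (by fun_prop) (by simpa using hτ')
    have := h.tendsto
    simp only [Complex.ofReal_zero, zero_add] at this
    exact this.mono_left nhdsWithin_le_nhds
  have h2 : Tendsto (fun ε : ℝ => ((ε : ℂ) + τ) ^ (-((α : ℂ) / 2)) *
      gaussLaplace α (a * ((ε : ℂ) + τ) ^ (-(1 / 2 : ℂ))) 1) (𝓝[>] 0)
      (𝓝 (τ ^ (-((α : ℂ) / 2)) * gaussLaplace α (a * τ ^ (-(1 / 2 : ℂ))) 1)) :=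
    (hpow _).mul (((continuous_gaussLaplace_one hα).tendsto _).comp ((hpow _).const_mul a))
  refine tendsto_nhds_unique (h1.congr' ?_) h2
  filter_upwards [self_mem_nhdsWithin] with ε hε
  have hε : 0 < ε := hε
  exact gaussLaplace_eq_cpow_mul hα a (by simp; linarith)

/-! ### The characteristic function as a parabolic cylinder function -/

lemma ofReal_mul_cpow {r : ℝ} (hr : 0 < r) {z : ℂ} (hz : z ≠ 0) (c : ℂ) :
    ((r : ℂ) * z) ^ c = (r : ℂ) ^ c * z ^ c := by
  have hr' : (r : ℂ) ≠ 0 := by exact_mod_cast hr.ne'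
  rw [Complex.cpow_def_of_ne_zero (mul_ne_zero hr' hz), Complex.cpow_def_of_ne_zero hr',
    Complex.cpow_def_of_ne_zero hz, Complex.log_ofReal_mul hr hz, Complex.ofReal_log hr.le, add_mul,
    Complex.exp_add]

/-- Here -it is the inverse of i/t, whose argument π/2 is not π, so principal powers commute with
inversion. -/
lemma neg_I_mul_ofReal_cpow_neg {t : ℝ} (ht : 0 < t) (c : ℂ) :
    (-(I * t)) ^ (-c) = ((1 / t : ℝ) : ℂ) ^ c * I ^ c := by
  have ht' : (t : ℂ) ≠ 0 := by exact_mod_cast ht.ne'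
  have e : -(I * (t : ℂ)) = (((1 / t : ℝ) : ℂ) * I)⁻¹ := by
    push_cast
    field_simp
    rw [Complex.I_sq, neg_neg]
  have harg : (((1 / t : ℝ) : ℂ) * I).arg ≠ Real.pi := by
    rw [Complex.arg_real_mul _ (by positivity), Complex.arg_I]
    linarith [Real.pi_pos]
  rw [e, Complex.cpow_neg, Complex.inv_cpow _ _ harg, inv_inv,
    ofReal_mul_cpow (by positivity) I_ne_zero]

lemma I_cpow_half_sq : (I ^ (1 / 2 : ℂ)) ^ 2 = I := by
  rw [← Complex.cpow_nat_mul]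
  norm_num

/-- Legendre's duplication formula, which brings out the factor 1/Γ(α) of the gamma density. -/
lemma parabolicCylinder_even_coeff {α : ℝ} (hα : 0 < α) :
    √Real.pi * (2 : ℝ) ^ (-α / 2) / Real.Gamma ((α + 1) / 2) =
      (2 : ℝ) ^ (α / 2) / 2 * Real.Gamma (α / 2) / Real.Gamma α := by
  have h := Real.Gamma_mul_Gamma_add_half (α / 2)
  rw [show α / 2 + 1 / 2 = (α + 1) / 2 by ring, mul_div_cancel₀ α two_ne_zero] at h
  have h1 := Real.Gamma_pos_of_pos hα
  have h2 := Real.Gamma_pos_of_pos (half_pos hα)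
  have h3 := Real.Gamma_pos_of_pos (show 0 < (α + 1) / 2 by positivity)
  rw [div_eq_div_iff h3.ne' h1.ne', mul_assoc _ (Real.Gamma (α / 2)), h]
  have e : (2 : ℝ) ^ (-α / 2) = (2 : ℝ) ^ (α / 2) / 2 * (2 : ℝ) ^ (1 - α) := by
    rw [Real.rpow_sub two_pos, Real.rpow_one, neg_div, Real.rpow_neg two_pos.le,
      show (2 : ℝ) ^ α = (2 : ℝ) ^ (α / 2) * (2 : ℝ) ^ (α / 2) by
        rw [← Real.rpow_add two_pos]; ring_nf]
    field_simp
  rw [e]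
  ring

lemma parabolicCylinder_odd_coeff {α : ℝ} (hα : 0 < α) :
    √Real.pi * (2 : ℝ) ^ ((1 - α) / 2) / Real.Gamma (α / 2) =
      (2 : ℝ) ^ (α / 2) / 2 * √2 * Real.Gamma ((α + 1) / 2) / Real.Gamma α := by
  have h := Real.Gamma_mul_Gamma_add_half (α / 2)
  rw [show α / 2 + 1 / 2 = (α + 1) / 2 by ring, mul_div_cancel₀ α two_ne_zero] at h
  have h1 := Real.Gamma_pos_of_pos hα
  have h2 := Real.Gamma_pos_of_pos (half_pos hα)
  have h3 := Real.Gamma_pos_of_pos (show 0 < (α + 1) / 2 by positivity)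
  rw [div_eq_div_iff h2.ne' h1.ne', mul_assoc _ (Real.Gamma ((α + 1) / 2)),
    mul_comm (Real.Gamma ((α + 1) / 2)), h]
  have e : (2 : ℝ) ^ ((1 - α) / 2) = (2 : ℝ) ^ (α / 2) / 2 * √2 * (2 : ℝ) ^ (1 - α) := by
    rw [Real.sqrt_eq_rpow, Real.rpow_sub two_pos 1 α, Real.rpow_one,
      show (2 : ℝ) ^ α = (2 : ℝ) ^ (α / 2) * (2 : ℝ) ^ (α / 2) by
        rw [← Real.rpow_add two_pos]; ring_nf, show (1 - α) / 2 = 1 / 2 - α / 2 by ring,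
      Real.rpow_sub two_pos]
    field_simp
  rw [e]
  ring

lemma gammaPsi_eq_gaussLaplace {α : ℝ} (hα : 0 < α) (s : ℝ) {t : ℝ} (ht : 0 < t) :
    gammaPsi α s t =
      gaussLaplace α (1 - I * (s : ℂ)) (-(I * (t : ℂ))) / (Real.Gamma α : ℂ) := by
  have hτ : -(I * (t : ℂ)) ∈ slitPlane := by
    rw [Complex.mem_slitPlane_iff]
    right
    simpa using ht.ne'
  have ht' : (t : ℂ) ≠ 0 := by exact_mod_cast ht.ne'
  rw [gaussLaplace_eq_cpow_mul_of_re_nonneg hα (by simp) (by simp) hτ,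
    gaussLaplace_eq_kummerM hα _ (by simp : 0 < (1 : ℂ).re), neg_I_mul_ofReal_cpow_neg ht,
    neg_I_mul_ofReal_cpow_neg ht]
  simp only [Complex.one_cpow, mul_one]
  set a : ℂ := 1 - I * (s : ℂ)
  set z : ℂ := I ^ (1 / 2 : ℂ) * a / ((√(2 * t) : ℝ) : ℂ) with hz
  have h2t : ((√(2 * t) : ℝ) : ℂ) ^ 2 = 2 * t := by
    rw [← Complex.ofReal_pow, Real.sq_sqrt (by positivity)]
    push_cast
    ring
  have hz2 : z ^ 2 = I * a ^ 2 / (2 * t) := by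
    rw [hz, div_pow, mul_pow, I_cpow_half_sq, h2t]
  -- Dividing by √t rather than √(2t) leaves a factor √2, which changes the Kummer argument y²/4
  -- into z²/2.
  have hy : a * (((1 / t : ℝ) : ℂ) ^ (1 / 2 : ℂ) * I ^ (1 / 2 : ℂ)) = (√2 : ℝ) * z := by
    have e : ((1 / t : ℝ) : ℂ) ^ (1 / 2 : ℂ) = ((√2 / √(2 * t) : ℝ) : ℂ) := by
      rw [show (1 / 2 : ℂ) = ((1 / 2 : ℝ) : ℂ) by push_cast; rfl,
        ← Complex.ofReal_cpow (by positivity), ← Real.sqrt_eq_rpow, ← Real.sqrt_div two_pos.le]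
      congr 2
      field_simp
    rw [e, hz]
    push_cast
    ring
  have hyz : ((√2 : ℝ) * z) ^ 2 / 4 = z ^ 2 / 2 := by
    rw [mul_pow, ← Complex.ofReal_pow, Real.sq_sqrt two_pos.le]
    push_cast
    ring
  have hw : (I / (2 * (t : ℂ))) ^ ((α : ℂ) / 2) * (((2 : ℝ) ^ (α / 2) : ℝ) : ℂ) =
      ((1 / t : ℝ) : ℂ) ^ ((α : ℂ) / 2) * I ^ ((α : ℂ) / 2) := by
    rw [show I / (2 * (t : ℂ)) = ((1 / (2 * t) : ℝ) : ℂ) * I by push_cast; ring,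
      ofReal_mul_cpow (by positivity) I_ne_zero,
      show (1 / t : ℝ) = 1 / (2 * t) * 2 by field_simp, Complex.ofReal_mul,
      Complex.mul_cpow_ofReal_nonneg (by positivity) two_pos.le,
      Complex.ofReal_cpow two_pos.le]
    push_cast
    ring
  -- The exponential prefactor of ψ exactly cancels the factor exp(-z²/4) in the parabolic cylinder
  -- function.
  have hexp : exp (I * a ^ 2 / (8 * t)) * exp (-z ^ 2 / 4) = 1 := by
    rw [← Complex.exp_add, hz2, ← Complex.exp_zero]
    congr 1
    ring
  rw [hy, hyz, gammaPsi, ← hz, parabolicCylinderD, parabolicCylinder_even_coeff hα,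
    parabolicCylinder_odd_coeff hα, ← hw]
  generalize kummerM ((α : ℂ) / 2) (1 / 2) (z ^ 2 / 2) = M₁
  generalize kummerM (((α : ℂ) + 1) / 2) (3 / 2) (z ^ 2 / 2) = M₂
  push_cast
  linear_combination ((I / (2 * (t : ℂ))) ^ ((α : ℂ) / 2) * (((2 : ℝ) ^ (α / 2) : ℝ) : ℂ) / 2 *
    (((Real.Gamma (α / 2) : ℝ) : ℂ) * M₁ - ((√2 : ℝ) : ℂ) * ((Real.Gamma ((α + 1) / 2) : ℝ) : ℂ) *
      z * M₂) / ((Real.Gamma α : ℝ) : ℂ)) * hexp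

lemma integral_gammaMeasure_cexp_eq_gammaPsi {α : ℝ} (hα : 0 < α) (s : ℝ) {t : ℝ} (ht : 0 < t) :
    ∫ x, exp (I * s * x + I * t * (x : ℂ) ^ 2) ∂(gammaMeasure α 1) = gammaPsi α s t := by
  rw [gammaPsi_eq_gaussLaplace hα s ht, integral_gammaMeasure_one hα, gaussLaplace,
    div_eq_inv_mul, ← integral_const_mul]
  refine setIntegral_congr_fun measurableSet_Ioi fun x hx => ?_
  rw [real_smul, show -(1 - I * (s : ℂ)) * x - -(I * t) * (x : ℂ) ^ 2 =
    ((-x : ℝ) : ℂ) + (I * s * x + I * t * (x : ℂ) ^ 2) by push_cast; ring]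
  generalize I * (s : ℂ) * x + I * t * (x : ℂ) ^ 2 = w
  rw [Complex.exp_add]
  push_cast
  ring

/-! ### Oscillatory integrals with quadratic phase -/

/-- Integration by parts: the amplitude enters only through its endpoint values and its total
variation. It serves the derivative tests, the decay of ψ and the sawtooth estimate. -/
lemma norm_integral_mul_deriv_le {f f' : ℝ → ℝ} {g g' : ℝ → ℂ} {a b M : ℝ} (hab : a ≤ b)
    (hf : ∀ x ∈ Set.Icc a b, HasDerivAt f (f' x) x) (hg : ∀ x ∈ Set.Icc a b, HasDerivAt g (g' x) x)
    (hf' : ContinuousOn f' (Set.Icc a b)) (hg' : ContinuousOn g' (Set.Icc a b))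
    (hM : ∀ x ∈ Set.Icc a b, ‖g x‖ ≤ M) :
    ‖∫ x in a..b, (f x : ℂ) * g' x‖ ≤ M * (|f a| + |f b| + ∫ x in a..b, |f' x|) := by
  have hM0 : 0 ≤ M := (norm_nonneg _).trans (hM a (Set.left_mem_Icc.2 hab))
  rw [← Set.uIcc_of_le hab] at hf hg hf' hg'
  have h1 : IntervalIntegrable (fun x => ((f' x : ℝ) : ℂ)) volume a b :=
    (Complex.continuous_ofReal.comp_continuousOn hf').intervalIntegrable
  rw [intervalIntegral.integral_mul_deriv_eq_deriv_mul (u := fun x => (f x : ℂ))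
    (u' := fun x => (f' x : ℂ)) (fun x hx => (hf x hx).ofReal_comp) hg h1 hg'.intervalIntegrable]
  have h2 : ‖∫ x in a..b, (f' x : ℂ) * g x‖ ≤ ∫ x in a..b, M * |f' x| := by
    refine intervalIntegral.norm_integral_le_of_norm_le hab ?_
      (hf'.abs.intervalIntegrable.const_mul M)
    refine ae_of_all _ fun x hx => ?_
    rw [norm_mul, norm_real, Real.norm_eq_abs, mul_comm]
    gcongr
    exact hM x (Set.Ioc_subset_Icc_self hx)
  rw [intervalIntegral.integral_const_mul] at h2
  have h3 : ‖(f b : ℂ) * g b‖ ≤ M * |f b| := by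
    rw [norm_mul, norm_real, Real.norm_eq_abs, mul_comm]
    gcongr
    exact hM b (Set.right_mem_Icc.2 hab)
  have h4 : ‖(f a : ℂ) * g a‖ ≤ M * |f a| := by
    rw [norm_mul, norm_real, Real.norm_eq_abs, mul_comm]
    gcongr
    exact hM a (Set.left_mem_Icc.2 hab)
  calc _ ≤ ‖(f b : ℂ) * g b‖ + ‖(f a : ℂ) * g a‖ + ‖∫ x in a..b, (f' x : ℂ) * g x‖ :=
        (norm_sub_le _ _).trans (by gcongr; exact norm_sub_le _ _)
    _ ≤ _ := by linarith

/-- The oscillating factor with quadratic phase. -/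
noncomputable def quadOsc (s t x : ℝ) : ℂ := exp (((s * x + t * x ^ 2 : ℝ) : ℂ) * I)

lemma norm_quadOsc (s t x : ℝ) : ‖quadOsc s t x‖ = 1 := Complex.norm_exp_ofReal_mul_I _

@[fun_prop]
lemma continuous_quadOsc (s t : ℝ) : Continuous (quadOsc s t) := by
  unfold quadOsc
  fun_prop

lemma hasDerivAt_quadOsc (s t x : ℝ) :
    HasDerivAt (quadOsc s t) (((s + 2 * t * x : ℝ) : ℂ) * I * quadOsc s t x) x := by
  have h : HasDerivAt (fun x : ℝ => s * x + t * x ^ 2) (s + 2 * t * x) x := by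
    have h1 : HasDerivAt (fun x : ℝ => s * x + t * x ^ 2) (s * 1 + t * ((2 : ℕ) * x ^ (2 - 1))) x :=
      ((hasDerivAt_id' x).const_mul s).add ((hasDerivAt_pow 2 x).const_mul t)
    exact h1.congr_deriv (by norm_num; ring)
  have h2 : HasDerivAt (quadOsc s t) (quadOsc s t x * (((s + 2 * t * x : ℝ) : ℂ) * I)) x :=
    (h.ofReal_comp.mul_const I).cexp
  exact h2.congr_deriv (by ring)

/-- First derivative test for a quadratic phase. -/
lemma norm_integral_quadOsc_le_of_le_abs {s t a b l : ℝ} (hab : a ≤ b) (ht : 0 < t) (hl : 0 < l)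
    (h : ∀ x ∈ Set.Icc a b, l ≤ |s + 2 * t * x|) :
    ‖∫ x in a..b, quadOsc s t x‖ ≤ 4 / l := by
  have hne : ∀ x ∈ Set.Icc a b, s + 2 * t * x ≠ 0 := fun x hx h0 => by
    have := h x hx
    rw [h0, abs_zero] at this
    linarith
  have hd : ∀ x ∈ Set.Icc a b, HasDerivAt (fun x => (s + 2 * t * x)⁻¹)
      (-(2 * t) / (s + 2 * t * x) ^ 2) x := fun x hx => by
    have h1 : HasDerivAt (fun x => s + 2 * t * x) (2 * t) x := by
      simpa using ((hasDerivAt_id x).const_mul (2 * t)).const_add s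
    exact h1.inv (hne x hx)
  have hc : ContinuousOn (fun x => -(2 * t) / (s + 2 * t * x) ^ 2) (Set.Icc a b) :=
    ContinuousOn.div (by fun_prop) (by fun_prop) fun x hx => pow_ne_zero 2 (hne x hx)
  -- The integrand is written as (1/φ') · (-i exp(iφ))'. The amplitude 1/φ' is monotone, so its
  -- variation telescopes and is at most 2/l, as are the endpoint terms together.
  have key := norm_integral_mul_deriv_le (g := fun x => -I * quadOsc s t x) (M := 1) hab hd
    (fun x _ => (hasDerivAt_quadOsc s t x).const_mul (-I)) hc (by fun_prop)
    (fun x _ => by simp [norm_quadOsc])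
  have e1 : ∫ x in a..b, quadOsc s t x = ∫ x in a..b, (((s + 2 * t * x)⁻¹ : ℝ) : ℂ) *
      (-I * (((s + 2 * t * x : ℝ) : ℂ) * I * quadOsc s t x)) := by
    refine intervalIntegral.integral_congr fun x hx => ?_
    rw [Set.uIcc_of_le hab] at hx
    have := hne x hx
    rw [← Complex.ofReal_ne_zero] at this
    rw [Complex.ofReal_inv]
    field_simp
    rw [Complex.I_sq]
    ring
  have e2 : ∫ x in a..b, |-(2 * t) / (s + 2 * t * x) ^ 2| =
      (s + 2 * t * a)⁻¹ - (s + 2 * t * b)⁻¹ := by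
    have : ∀ x, |-(2 * t) / (s + 2 * t * x) ^ 2| = -(-(2 * t) / (s + 2 * t * x) ^ 2) := fun x => by
      rw [abs_of_nonpos]
      exact div_nonpos_of_nonpos_of_nonneg (by linarith) (by positivity)
    simp_rw [this]
    rw [← Set.uIcc_of_le hab] at hd hc
    rw [intervalIntegral.integral_neg, intervalIntegral.integral_eq_sub_of_hasDerivAt hd
      hc.intervalIntegrable]
    ring
  have hb : ∀ x ∈ Set.Icc a b, |(s + 2 * t * x)⁻¹| ≤ 1 / l := fun x hx => by
    rw [abs_inv, ← one_div]
    exact one_div_le_one_div_of_le hl (h x hx)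
  have ha' := hb a (Set.left_mem_Icc.2 hab)
  have hb' := hb b (Set.right_mem_Icc.2 hab)
  rw [e1]
  refine key.trans ?_
  rw [e2]
  have h1 := le_abs_self (s + 2 * t * a)⁻¹
  have h2 := neg_le_abs (s + 2 * t * b)⁻¹
  have h3 : 4 / l = 4 * (1 / l) := by ring
  rw [h3]
  linarith

/-- Second derivative test for a quadratic phase. -/
lemma norm_integral_quadOsc_le {s t a b : ℝ} (hab : a ≤ b) (ht : 0 < t) :
    ‖∫ x in a..b, quadOsc s t x‖ ≤ 6 / √t := by
  have hst : 0 < √t := Real.sqrt_pos.2 ht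
  have hsq : √t * √t = t := Real.mul_self_sqrt ht.le
  -- Stationary point of the phase, and the radius d = 1/√t at which the trivial bound 2d balances
  -- the first derivative test with l = 2td = 2√t.
  set x₀ := -s / (2 * t) with hx₀
  set d := 1 / √t with hd
  have hd0 : 0 < d := by positivity
  have htd : t * d = √t := by rw [hd, mul_one_div, div_eq_iff hst.ne', hsq]
  -- The points x₀ ± d are clamped to [a, b]; an outer piece may be empty and is then treated
  -- separately.
  set c₁ := max a (min b (x₀ - d)) with hc₁
  set c₂ := max a (min b (x₀ + d)) with hc₂
  have hac₁ : a ≤ c₁ := le_max_left _ _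
  have hc₁₂ : c₁ ≤ c₂ := max_le_max le_rfl (min_le_min le_rfl (by linarith))
  have hc₂b : c₂ ≤ b := max_le hab (min_le_left _ _)
  have hphase : ∀ x, s + 2 * t * x = 2 * t * (x - x₀) := fun x => by rw [hx₀]; field_simp; ring
  have hint : ∀ u v, IntervalIntegrable (quadOsc s t) volume u v := fun u v =>
    (continuous_quadOsc s t).intervalIntegrable u v
  have h1 : ‖∫ x in a..c₁, quadOsc s t x‖ ≤ 4 / (2 * √t) := by
    rcases eq_or_lt_of_le hac₁ with h | h
    · rw [← h, intervalIntegral.integral_same, norm_zero]; positivity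
    · refine norm_integral_quadOsc_le_of_le_abs hac₁ ht (by positivity) fun x hx => ?_
      have : c₁ ≤ x₀ - d := by
        rcases le_max_iff.1 (le_refl c₁) with h' | h'
        · linarith
        · exact h'.trans (min_le_right _ _)
      rw [hphase, abs_of_nonpos (by nlinarith [hx.2])]
      nlinarith [hx.2]
  have h3 : ‖∫ x in c₂..b, quadOsc s t x‖ ≤ 4 / (2 * √t) := by
    rcases eq_or_lt_of_le hc₂b with h | h
    · rw [← h, intervalIntegral.integral_same, norm_zero]; positivity
    · refine norm_integral_quadOsc_le_of_le_abs hc₂b ht (by positivity) fun x hx => ?_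
      have : x₀ + d ≤ c₂ := by
        rw [hc₂, le_max_iff]
        right
        refine le_min ?_ le_rfl
        by_contra hcon
        push Not at hcon
        rw [hc₂, min_eq_left hcon.le] at h
        exact absurd h (not_lt.2 (le_max_right _ _))
      rw [hphase, abs_of_nonneg (by nlinarith [hx.1])]
      nlinarith [hx.1]
  have h2 : ‖∫ x in c₁..c₂, quadOsc s t x‖ ≤ 2 * d := by
    refine (intervalIntegral.norm_integral_le_of_norm_le_const (C := 1)
      fun x _ => (norm_quadOsc s t x).le).trans ?_
    rw [one_mul, abs_of_nonneg (by linarith)]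
    have : c₂ - c₁ ≤ 2 * d := by
      have h5 : c₂ ≤ c₁ + 2 * d := by
        refine max_le (by linarith) ?_
        have : min b (x₀ + d) ≤ min b (x₀ - d) + 2 * d := by
          rw [← min_add_add_right]
          exact min_le_min (by linarith) (by linarith)
        have h6 : min b (x₀ - d) ≤ c₁ := le_max_right _ _
        linarith
      linarith
    exact this
  rw [← intervalIntegral.integral_add_adjacent_intervals (hint a c₁) (hint c₁ b),
    ← intervalIntegral.integral_add_adjacent_intervals (hint c₁ c₂) (hint c₂ b)]
  have e : 6 / √t = 4 / (2 * √t) + (2 * d + 4 / (2 * √t)) := by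
    rw [hd]; field_simp; norm_num
  rw [e]
  exact (norm_add_le _ _).trans (add_le_add h1 ((norm_add_le _ _).trans (add_le_add h2 h3)))

/-! ### Decay of the characteristic function -/

lemma exists_rpow_mul_exp_neg_half_le {c : ℝ} (hc : 0 ≤ c) :
    ∃ C : ℝ, 0 < C ∧ ∀ x : ℝ, 0 < x → x ^ c * Real.exp (-(x / 2)) ≤ C := by
  obtain ⟨N, hN⟩ := exists_nat_ge c
  -- From x^c ≤ 1 + x^N with N ≥ c, and (x/2)^N / N! ≤ exp(x/2).
  refine ⟨1 + 2 ^ N * N.factorial, by positivity, fun x hx => ?_⟩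
  have h1 : x ^ c ≤ 1 + x ^ N := by
    rcases le_total x 1 with h | h
    · have := Real.rpow_le_one hx.le h hc
      have : 0 ≤ x ^ N := by positivity
      linarith
    · have := Real.rpow_le_rpow_of_exponent_le h hN
      rw [Real.rpow_natCast] at this
      linarith
  have h2 : x ^ N ≤ 2 ^ N * N.factorial * Real.exp (x / 2) := by
    have := Real.pow_div_factorial_le_exp (x / 2) (by positivity) N
    rw [div_le_iff₀ (by positivity), div_pow, div_le_iff₀ (by positivity)] at this
    linarith
  have h3 : 1 ≤ Real.exp (x / 2) := Real.one_le_exp (by positivity)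
  rw [Real.exp_neg, ← div_eq_mul_inv, div_le_iff₀ (Real.exp_pos _)]
  nlinarith

lemma hasDerivAt_rpow_mul_exp_neg (α : ℝ) {x : ℝ} (hx : 0 < x) :
    HasDerivAt (fun x : ℝ => x ^ (α - 1) * Real.exp (-x))
      (((α - 1) * x ^ (α - 2) - x ^ (α - 1)) * Real.exp (-x)) x := by
  have h1 := Real.hasDerivAt_rpow_const (p := α - 1) (Or.inl hx.ne')
  have h2 : HasDerivAt (fun x : ℝ => Real.exp (-x)) (Real.exp (-x) * -1) x :=
    (hasDerivAt_neg x).exp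
  refine (h1.mul h2).congr_deriv ?_
  rw [show α - 1 - 1 = α - 2 by ring]
  ring

/-- Half of the exponential absorbs the surplus power x^(α-β). Lowering the exponent to some β < 1
makes the envelope x^(β-1) decreasing and x^(β-2) integrable at infinity, also when α ≥ 1. -/
lemma exists_gammaAmplitude_bound {α β : ℝ} (hβα : β ≤ α) :
    ∃ C : ℝ, 0 < C ∧ ∀ x : ℝ, 0 < x →
      x ^ (α - 1) * Real.exp (-x) ≤ C * (x ^ (β - 1) * Real.exp (-(x / 2))) ∧
      |((α - 1) * x ^ (α - 2) - x ^ (α - 1)) * Real.exp (-x)| ≤ C * x ^ (β - 2) := by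
  obtain ⟨C₁, hC₁, h₁⟩ := exists_rpow_mul_exp_neg_half_le (sub_nonneg.2 hβα)
  obtain ⟨C₂, hC₂, h₂⟩ := exists_rpow_mul_exp_neg_half_le
    (show (0 : ℝ) ≤ α - β + 1 by linarith)
  refine ⟨C₁ + |α - 1| * C₁ + C₂, by positivity, fun x hx => ⟨?_, ?_⟩⟩
  · have e : x ^ (α - 1) * Real.exp (-x) =
        (x ^ (α - β) * Real.exp (-(x / 2))) * (x ^ (β - 1) * Real.exp (-(x / 2))) := by
      rw [show α - 1 = (α - β) + (β - 1) by ring, Real.rpow_add hx,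
        show -x = -(x / 2) + -(x / 2) by ring, Real.exp_add]
      ring
    rw [e]
    gcongr
    have : 0 ≤ |α - 1| * C₁ := by positivity
    linarith [h₁ x hx]
  · have e : ((α - 1) * x ^ (α - 2) - x ^ (α - 1)) * Real.exp (-x) =
        ((α - 1) * (x ^ (α - β) * Real.exp (-(x / 2))) -
          x ^ (α - β + 1) * Real.exp (-(x / 2))) * Real.exp (-(x / 2)) * x ^ (β - 2) := by
      rw [show α - 2 = (α - β) + (β - 2) by ring, show α - 1 = (α - β + 1) + (β - 2) by ring,
        Real.rpow_add hx, Real.rpow_add hx (α - β + 1),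
        show -x = -(x / 2) + -(x / 2) by ring, Real.exp_add]
      ring
    rw [e, abs_mul, abs_mul, Real.abs_exp, abs_of_pos (Real.rpow_pos_of_pos hx (β - 2))]
    gcongr
    have h3 : Real.exp (-(x / 2)) ≤ 1 := Real.exp_le_one_iff.2 (by linarith)
    have h4 : |(α - 1) * (x ^ (α - β) * Real.exp (-(x / 2))) -
        x ^ (α - β + 1) * Real.exp (-(x / 2))| ≤ |α - 1| * C₁ + C₂ := by
      refine (abs_sub _ _).trans (add_le_add ?_ ?_)
      · rw [abs_mul, abs_of_nonneg (by positivity : 0 ≤ x ^ (α - β) * Real.exp (-(x / 2)))]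
        gcongr
        exact h₁ x hx
      · rw [abs_of_nonneg (by positivity)]
        exact h₂ x hx
    calc _ ≤ (|α - 1| * C₁ + C₂) * 1 := by gcongr
      _ ≤ _ := by linarith

/-- The oscillatory integral whose normalization is the characteristic function. -/
lemma gammaPsi_eq_integral_quadOsc {α : ℝ} (hα : 0 < α) (s : ℝ) {t : ℝ} (ht : 0 < t) :
    gammaPsi α s t = (Real.Gamma α : ℂ)⁻¹ *
      ∫ x in Set.Ioi (0 : ℝ), ((x ^ (α - 1) * Real.exp (-x) : ℝ) : ℂ) * quadOsc s t x := by
  rw [← integral_gammaMeasure_cexp_eq_gammaPsi hα s ht, integral_gammaMeasure_one hα,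
    ← integral_const_mul]
  refine setIntegral_congr_fun measurableSet_Ioi fun x hx => ?_
  rw [real_smul, quadOsc]
  push_cast
  ring_nf

lemma integral_rpow_sub_two_le {β a b : ℝ} (hβ : β < 1) (ha : 0 < a) (hab : a ≤ b) :
    ∫ x in a..b, x ^ (β - 2) ≤ a ^ (β - 1) / (1 - β) := by
  rw [integral_rpow (Or.inr ⟨by linarith, by
    rw [Set.uIcc_of_le hab]; exact fun h => absurd h.1 (by linarith)⟩)]
  rw [show β - 2 + 1 = -(1 - β) by ring, div_neg, ← neg_div, neg_sub,
    show -(1 - β) = β - 1 by ring]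
  have h1 : 0 ≤ b ^ (β - 1) := Real.rpow_nonneg (by linarith) _
  exact div_le_div_of_nonneg_right (by linarith) (by linarith)

lemma integrableOn_gammaAmplitude_mul_quadOsc {α : ℝ} (hα : 0 < α) (s t : ℝ) :
    IntegrableOn (fun x : ℝ => ((x ^ (α - 1) * Real.exp (-x) : ℝ) : ℂ) * quadOsc s t x)
      (Set.Ioi 0) := by
  have h := integrableOn_rpow_mul_exp_neg_mul hα one_pos
  simp only [one_mul] at h
  refine Integrable.mono h (by fun_prop) (ae_of_all _ fun x => ?_)
  rw [norm_mul, norm_quadOsc, norm_real, mul_one]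

/-- The oscillatory integral away from the origin, by parts. -/
lemma exists_norm_integral_middle_le {α β : ℝ} (hβ : β < 1) (hβα : β ≤ α) :
    ∃ C : ℝ, 0 < C ∧ ∀ s t a b M : ℝ, 0 < a → a ≤ b →
      (∀ x ∈ Set.Icc a b, ‖∫ u in a..x, quadOsc s t u‖ ≤ M) →
      ‖∫ x in a..b, ((x ^ (α - 1) * Real.exp (-x) : ℝ) : ℂ) * quadOsc s t x‖ ≤
        C * M * a ^ (β - 1) := by
  obtain ⟨C, hC, h⟩ := exists_gammaAmplitude_bound hβα
  have hβ' : 0 < 1 - β := by linarith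
  -- Two endpoint values, each at most C a^(β-1), and a variation of at most C a^(β-1)/(1-β).
  refine ⟨C * (2 + 1 / (1 - β)), by positivity, fun s t a b M ha hab hM => ?_⟩
  have hM0 : 0 ≤ M := (norm_nonneg _).trans (hM a (Set.left_mem_Icc.2 hab))
  have hpos : ∀ x ∈ Set.Icc a b, 0 < x := fun x hx => ha.trans_le hx.1
  have hc : ContinuousOn (fun x : ℝ => ((α - 1) * x ^ (α - 2) - x ^ (α - 1)) * Real.exp (-x))
      (Set.Icc a b) := by
    have : ∀ p : ℝ, ContinuousOn (fun x : ℝ => x ^ p) (Set.Icc a b) := fun p x hx =>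
      (Real.continuousAt_rpow_const _ _ (Or.inl (hpos x hx).ne')).continuousWithinAt
    exact ((continuousOn_const.mul (this _)).sub (this _)).mul (by fun_prop)
  have key := norm_integral_mul_deriv_le (g := fun x => ∫ u in a..x, quadOsc s t u) hab
    (fun x hx => hasDerivAt_rpow_mul_exp_neg α (hpos x hx))
    (fun x _ => (continuous_quadOsc s t).integral_hasStrictDerivAt a x |>.hasDerivAt) hc
    (by fun_prop) hM
  refine key.trans ?_
  have hamp : ∀ x ∈ Set.Icc a b, |x ^ (α - 1) * Real.exp (-x)| ≤ C * a ^ (β - 1) := by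
    intro x hx
    have hx0 := hpos x hx
    rw [abs_of_nonneg (by positivity)]
    refine (h x hx0).1.trans ?_
    gcongr
    calc x ^ (β - 1) * Real.exp (-(x / 2)) ≤ a ^ (β - 1) * 1 :=
          mul_le_mul (Real.rpow_le_rpow_of_nonpos ha hx.1 (by linarith))
            (Real.exp_le_one_iff.2 (by linarith)) (Real.exp_pos _).le (by positivity)
      _ = _ := mul_one _
  have hint : ∫ x in a..b, |((α - 1) * x ^ (α - 2) - x ^ (α - 1)) * Real.exp (-x)| ≤
      C * (a ^ (β - 1) / (1 - β)) := by
    calc _ ≤ ∫ x in a..b, C * x ^ (β - 2) := by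
          refine intervalIntegral.integral_mono_on hab ?_ ?_ fun x hx => (h x (hpos x hx)).2
          · rw [← Set.uIcc_of_le hab] at hc
            exact hc.abs.intervalIntegrable
          · refine (intervalIntegral.intervalIntegrable_rpow (Or.inr ?_)).const_mul C
            rw [Set.uIcc_of_le hab]
            exact fun h => absurd h.1 (by linarith)
      _ ≤ _ := by
          rw [intervalIntegral.integral_const_mul]
          gcongr
          exact integral_rpow_sub_two_le hβ ha hab
  calc _ ≤ M * (C * a ^ (β - 1) + C * a ^ (β - 1) + C * (a ^ (β - 1) / (1 - β))) := by
        gcongr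
        · exact hamp a (Set.left_mem_Icc.2 hab)
        · exact hamp b (Set.right_mem_Icc.2 hab)
    _ = _ := by ring

/-- The oscillatory integral near the origin. -/
lemma exists_norm_integral_head_le {α β : ℝ} (hβ0 : 0 < β) (hβα : β ≤ α) :
    ∃ C : ℝ, 0 < C ∧ ∀ s t a : ℝ, 0 < a →
      ‖∫ x in (0 : ℝ)..a, ((x ^ (α - 1) * Real.exp (-x) : ℝ) : ℂ) * quadOsc s t x‖ ≤
        C * a ^ β := by
  obtain ⟨C, hC, h⟩ := exists_gammaAmplitude_bound hβα
  refine ⟨C / β, by positivity, fun s t a ha => ?_⟩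
  have h1 : ∫ x in (0 : ℝ)..a, C * x ^ (β - 1) = C / β * a ^ β := by
    rw [intervalIntegral.integral_const_mul, integral_rpow (Or.inl (by linarith))]
    simp [Real.zero_rpow hβ0.ne']
    ring
  rw [← h1]
  refine intervalIntegral.norm_integral_le_of_norm_le ha.le (ae_of_all _ fun x hx => ?_)
    ((intervalIntegral.intervalIntegrable_rpow' (by linarith)).const_mul C)
  have hx0 : 0 < x := hx.1
  rw [norm_mul, norm_quadOsc, norm_real, mul_one, Real.norm_of_nonneg (by positivity)]
  refine (h x hx0).1.trans ?_
  gcongr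
  exact mul_le_of_le_one_right (by positivity) (Real.exp_le_one_iff.2 (by linarith))

/-- The oscillatory integral near infinity. -/
lemma exists_norm_integral_tail_le {α β : ℝ} (hβ0 : 0 < β) (hβα : β ≤ α) :
    ∃ C : ℝ, 0 < C ∧ ∀ s t b : ℝ, 0 < b →
      ‖∫ x in Set.Ioi b, ((x ^ (α - 1) * Real.exp (-x) : ℝ) : ℂ) * quadOsc s t x‖ ≤
        C * Real.exp (-(b / 4)) := by
  obtain ⟨C, hC, h⟩ := exists_gammaAmplitude_bound hβα
  have hI := integrableOn_rpow_mul_exp_neg_mul hβ0 (show (0 : ℝ) < 1 / 4 by norm_num)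
  -- Beyond b one has exp(-x/2) ≤ exp(-b/4) exp(-x/4); the summand 1 only ensures positivity.
  refine ⟨C * (∫ x in Set.Ioi (0 : ℝ), x ^ (β - 1) * Real.exp (-(1 / 4 * x))) + 1, ?_,
    fun s t b hb => ?_⟩
  · have : 0 ≤ ∫ x in Set.Ioi (0 : ℝ), x ^ (β - 1) * Real.exp (-(1 / 4 * x)) :=
      setIntegral_nonneg measurableSet_Ioi fun x hx => by
        have : 0 < x := hx
        positivity
    positivity
  have hsub : Set.Ioi b ⊆ Set.Ioi (0 : ℝ) := Set.Ioi_subset_Ioi hb.le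
  have h1 : ‖∫ x in Set.Ioi b, ((x ^ (α - 1) * Real.exp (-x) : ℝ) : ℂ) * quadOsc s t x‖ ≤
      ∫ x in Set.Ioi b, C * Real.exp (-(b / 4)) * (x ^ (β - 1) * Real.exp (-(1 / 4 * x))) := by
    refine norm_integral_le_of_norm_le ((hI.mono_set hsub).const_mul _) ?_
    filter_upwards [ae_restrict_mem measurableSet_Ioi] with x hx
    have hx0 : 0 < x := hsub hx
    have hx : b < x := hx
    rw [norm_mul, norm_quadOsc, norm_real, mul_one, Real.norm_of_nonneg (by positivity)]
    refine (h x hx0).1.trans ?_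
    have : Real.exp (-(x / 2)) ≤ Real.exp (-(b / 4)) * Real.exp (-(1 / 4 * x)) := by
      rw [← Real.exp_add, Real.exp_le_exp]
      linarith
    calc _ ≤ C * (x ^ (β - 1) * (Real.exp (-(b / 4)) * Real.exp (-(1 / 4 * x)))) := by gcongr
      _ = _ := by ring
  refine h1.trans ?_
  rw [integral_const_mul]
  have h2 : ∫ x in Set.Ioi b, x ^ (β - 1) * Real.exp (-(1 / 4 * x)) ≤
      ∫ x in Set.Ioi (0 : ℝ), x ^ (β - 1) * Real.exp (-(1 / 4 * x)) := by
    refine setIntegral_mono_set hI ?_ hsub.eventuallyLE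
    filter_upwards [ae_restrict_mem measurableSet_Ioi] with x hx
    have : 0 < x := hx
    positivity
  have h3 := Real.exp_pos (-(b / 4))
  calc _ ≤ C * Real.exp (-(b / 4)) *
        ∫ x in Set.Ioi (0 : ℝ), x ^ (β - 1) * Real.exp (-(1 / 4 * x)) := by gcongr
    _ ≤ _ := by nlinarith

/-- Uniform decay of the characteristic function in the quadratic variable. -/
lemma exists_norm_gammaPsi_le_rpow {α β : ℝ} (hα : 0 < α) (hβ0 : 0 < β) (hβ : β < 1)
    (hβα : β ≤ α) :
    ∃ C : ℝ, 0 < C ∧ ∀ s t : ℝ, 0 < t → ‖gammaPsi α s t‖ ≤ C * t ^ (-(β / 2)) := by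
  obtain ⟨C₁, hC₁, h₁⟩ := exists_norm_integral_head_le hβ0 hβα
  obtain ⟨C₂, hC₂, h₂⟩ := exists_norm_integral_middle_le hβ hβα
  have hG := Real.Gamma_pos_of_pos hα
  refine ⟨(Real.Gamma α)⁻¹ * (C₁ + 6 * C₂), by positivity, fun s t ht => ?_⟩
  rw [gammaPsi_eq_integral_quadOsc hα s ht, norm_mul, norm_inv, norm_real,
    Real.norm_of_nonneg hG.le, mul_assoc]
  gcongr
  have hI := integrableOn_gammaAmplitude_mul_quadOsc hα s t
  refine le_of_tendsto (intervalIntegral_tendsto_integral_Ioi 0 hI tendsto_id).norm ?_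
  -- This cut balances the head a^β against the remainder t^(-1/2) a^(β-1).
  set a := t ^ (-(1 / 2) : ℝ) with ha
  have ha0 : 0 < a := Real.rpow_pos_of_pos ht _
  filter_upwards [eventually_ge_atTop a] with b hb
  have hb0 : 0 < b := ha0.trans_le hb
  have hi : ∀ u v, 0 ≤ u → u ≤ v → IntervalIntegrable
      (fun x : ℝ => ((x ^ (α - 1) * Real.exp (-x) : ℝ) : ℂ) * quadOsc s t x) volume u v := by
    intro u v hu huv
    rw [intervalIntegrable_iff_integrableOn_Ioc_of_le huv]
    exact hI.mono_set fun x hx => lt_of_le_of_lt hu hx.1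
  simp only [id]
  rw [← intervalIntegral.integral_add_adjacent_intervals (hi 0 a le_rfl ha0.le) (hi a b ha0.le hb)]
  refine (norm_add_le _ _).trans ?_
  have e1 : a ^ β = t ^ (-(β / 2)) := by rw [ha, ← Real.rpow_mul ht.le]; ring_nf
  have e2 : 6 / √t * a ^ (β - 1) = 6 * t ^ (-(β / 2)) := by
    rw [ha, ← Real.rpow_mul ht.le, Real.sqrt_eq_rpow, div_eq_mul_inv, ← Real.rpow_neg ht.le,
      mul_assoc, ← Real.rpow_add ht]
    ring_nf
  have h3 := h₂ s t a b (6 / √t) ha0 hb fun x hx => norm_integral_quadOsc_le hx.1 ht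
  have h4 := h₁ s t a ha0
  rw [e1] at h4
  rw [mul_assoc, e2] at h3
  linarith

/-- Decay of the characteristic function in the linear variable. -/
lemma exists_norm_gammaPsi_le_rpow_add_exp {α β : ℝ} (hα : 0 < α) (hβ0 : 0 < β) (hβ : β < 1)
    (hβα : β ≤ α) :
    ∃ C : ℝ, 0 < C ∧ ∀ s t : ℝ, s ≠ 0 → 0 < t →
      ‖gammaPsi α s t‖ ≤ C * (|s| ^ (-β) + Real.exp (-(|s| / (16 * t)))) := by
  obtain ⟨C₁, hC₁, h₁⟩ := exists_norm_integral_head_le hβ0 hβα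
  obtain ⟨C₂, hC₂, h₂⟩ := exists_norm_integral_middle_le hβ hβα
  obtain ⟨C₃, hC₃, h₃⟩ := exists_norm_integral_tail_le hβ0 hβα
  have hG := Real.Gamma_pos_of_pos hα
  refine ⟨(Real.Gamma α)⁻¹ * (C₁ + 8 * C₂ + C₃), by positivity, fun s t hs ht => ?_⟩
  rw [gammaPsi_eq_integral_quadOsc hα s ht, norm_mul, norm_inv, norm_real,
    Real.norm_of_nonneg hG.le, mul_assoc]
  gcongr
  have hI := integrableOn_gammaAmplitude_mul_quadOsc hα s t
  set σ := |s| with hσ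
  have hσ0 : 0 < σ := abs_pos.2 hs
  -- The head costs |s|^(-β), as does the middle with first derivative bound 8/|s|.
  set a := 1 / σ with ha
  have ha0 : 0 < a := by positivity
  -- Up to b the quadratic part 2tx of the phase derivative is at most |s|/2, so the linear part
  -- prevails.
  set b := σ / (4 * t) with hb
  have hb0 : 0 < b := by positivity
  have e1 : a ^ β = σ ^ (-β) := by
    rw [ha, one_div, Real.inv_rpow hσ0.le, Real.rpow_neg hσ0.le]
  have e3 : Real.exp (-(b / 4)) = Real.exp (-(σ / (16 * t))) := by
    rw [hb]; congr 1; field_simp; norm_num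
  have hi : ∀ u v, 0 ≤ u → u ≤ v → IntervalIntegrable
      (fun x : ℝ => ((x ^ (α - 1) * Real.exp (-x) : ℝ) : ℂ) * quadOsc s t x) volume u v := by
    intro u v hu huv
    rw [intervalIntegrable_iff_integrableOn_Ioc_of_le huv]
    exact hI.mono_set fun x hx => lt_of_le_of_lt hu hx.1
  have hsplit : ∀ v, 0 ≤ v →
      ∫ x in Set.Ioi (0 : ℝ), ((x ^ (α - 1) * Real.exp (-x) : ℝ) : ℂ) * quadOsc s t x =
      (∫ x in (0 : ℝ)..v, ((x ^ (α - 1) * Real.exp (-x) : ℝ) : ℂ) * quadOsc s t x) +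
      ∫ x in Set.Ioi v, ((x ^ (α - 1) * Real.exp (-x) : ℝ) : ℂ) * quadOsc s t x := by
    intro v hv
    rw [intervalIntegral.integral_interval_add_Ioi hI (hI.mono_set (Set.Ioi_subset_Ioi hv))]
  have h4 := h₁ s t a ha0
  rw [e1] at h4
  have hp : 0 < σ ^ (-β) := Real.rpow_pos_of_pos hσ0 _
  have hq := Real.exp_pos (-(σ / (16 * t)))
  rcases le_total a b with hab | hab
  · rw [hsplit b hb0.le, ← intervalIntegral.integral_add_adjacent_intervals
      (hi 0 a le_rfl ha0.le) (hi a b ha0.le hab)]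
    have h5 := h₃ s t b hb0
    rw [e3] at h5
    have h6 := h₂ s t a b (8 / σ) ha0 hab fun x hx => by
      have := norm_integral_quadOsc_le_of_le_abs (s := s) hx.1 ht (half_pos hσ0) fun y hy => by
        have hy0 : 0 < y := ha0.trans_le hy.1
        have hyb : y ≤ σ / (4 * t) := hy.2.trans hx.2
        rw [le_div_iff₀ (by positivity)] at hyb
        have h7 : |s| ≤ |s + 2 * t * y| + |2 * t * y| := by
          have := abs_sub (s + 2 * t * y) (2 * t * y)
          simpa using this
        rw [abs_of_pos (by positivity : 0 < 2 * t * y), ← hσ] at h7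
        linarith
      refine this.trans (le_of_eq ?_)
      field_simp
      norm_num
    have e2 : 8 / σ * a ^ (β - 1) = 8 * σ ^ (-β) := by
      rw [ha, one_div, Real.inv_rpow hσ0.le, ← Real.rpow_neg hσ0.le, neg_sub,
        Real.rpow_sub hσ0, Real.rpow_one, Real.rpow_neg hσ0.le]
      field_simp
    rw [mul_assoc, e2] at h6
    refine (norm_add_le _ _).trans ((add_le_add (norm_add_le _ _) le_rfl).trans ?_)
    nlinarith
  -- If b ≤ a the middle range is void, and the tail beyond a is no larger than the bound for the
  -- tail beyond b.
  · rw [hsplit a ha0.le]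
    have h5 := h₃ s t a ha0
    have h6 : Real.exp (-(a / 4)) ≤ Real.exp (-(σ / (16 * t))) := by
      rw [← e3, Real.exp_le_exp]
      linarith
    refine (norm_add_le _ _).trans ?_
    have h7 : C₃ * Real.exp (-(a / 4)) ≤ C₃ * Real.exp (-(σ / (16 * t))) := by gcongr
    nlinarith

lemma norm_gammaPsi_le_one {α : ℝ} (hα : 0 < α) (s : ℝ) {t : ℝ} (ht : 0 < t) :
    ‖gammaPsi α s t‖ ≤ 1 := by
  have := isProbabilityMeasure_gammaMeasure hα one_pos
  rw [← integral_gammaMeasure_cexp_eq_gammaPsi hα s ht]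
  refine (norm_integral_le_of_norm_le_const (C := 1) (ae_of_all _ fun x => ?_)).trans (by simp)
  rw [show I * s * x + I * t * (x : ℂ) ^ 2 = ((s * x + t * x ^ 2 : ℝ) : ℂ) * I by push_cast; ring,
    Complex.norm_exp_ofReal_mul_I]

lemma continuous_gammaPsi {α : ℝ} (hα : 0 < α) {t : ℝ} (ht : 0 < t) :
    Continuous (fun s : ℝ => gammaPsi α s t) := by
  have := isProbabilityMeasure_gammaMeasure hα one_pos
  simp_rw [← integral_gammaMeasure_cexp_eq_gammaPsi hα _ ht]
  refine continuous_of_dominated (bound := fun _ => 1) (fun s => by fun_prop) (fun s => ?_)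
    (integrable_const _) (ae_of_all _ fun x => by fun_prop)
  refine ae_of_all _ fun x => ?_
  rw [show I * s * x + I * t * (x : ℂ) ^ 2 = ((s * x + t * x ^ 2 : ℝ) : ℂ) * I by push_cast; ring,
    Complex.norm_exp_ofReal_mul_I]

/-- For fixed t the exponential term is itself O(|s|^(-β)), since exp(-y) ≤ 1/y and β < 1; for |s| ≤
1 the bound |ψ| ≤ 1 suffices. -/
lemma exists_norm_gammaPsi_le_one_add_abs {α β t : ℝ} (hα : 0 < α) (hβ0 : 0 < β) (hβ : β < 1)
    (hβα : β ≤ α) (ht : 0 < t) :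
    ∃ C : ℝ, 0 < C ∧ ∀ s : ℝ, ‖gammaPsi α s t‖ ≤ C * (1 + |s|) ^ (-β) := by
  obtain ⟨C, hC, h⟩ := exists_norm_gammaPsi_le_rpow_add_exp hα hβ0 hβ hβα
  refine ⟨(1 + C * (1 + 16 * t)) * 2 ^ β, by positivity, fun s => ?_⟩
  have hw : 0 < 1 + |s| := by positivity
  have h2 : ((1 + |s|) / 2) ^ (-β) = 2 ^ β * (1 + |s|) ^ (-β) := by
    rw [Real.div_rpow hw.le two_pos.le, Real.rpow_neg two_pos.le, div_inv_eq_mul, mul_comm]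
  rw [mul_assoc, ← h2]
  rcases le_total |s| 1 with hs | hs
  · have h3 : 1 ≤ ((1 + |s|) / 2) ^ (-β) :=
      Real.one_le_rpow_of_pos_of_le_one_of_nonpos (by positivity) (by linarith) (by linarith)
    have h4 := norm_gammaPsi_le_one hα s ht
    have : 0 ≤ C * (1 + 16 * t) := by positivity
    nlinarith
  · have hs0 : 0 < |s| := by linarith
    have h3 : |s| ^ (-β) ≤ ((1 + |s|) / 2) ^ (-β) :=
      Real.rpow_le_rpow_of_nonpos (by positivity) (by linarith) (by linarith)
    have h4 : Real.exp (-(|s| / (16 * t))) ≤ 16 * t * |s| ^ (-β) := by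
      have h5 : |s| / (16 * t) ≤ Real.exp (|s| / (16 * t)) := by
        linarith [Real.add_one_le_exp (|s| / (16 * t))]
      have h6 : |s| ^ β ≤ |s| := by
        simpa using Real.rpow_le_rpow_of_exponent_le hs hβ.le
      rw [Real.exp_neg, Real.rpow_neg hs0.le, ← div_eq_mul_inv,
        inv_le_comm₀ (Real.exp_pos _) (by positivity), inv_div]
      refine le_trans ?_ h5
      gcongr
    have h5 := h s t (abs_pos.1 hs0) ht
    have h6 : |s| ^ (-β) + Real.exp (-(|s| / (16 * t))) ≤ (1 + 16 * t) * |s| ^ (-β) := by linarith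
    have h7 : 0 ≤ ((1 + |s|) / 2) ^ (-β) := by positivity
    calc _ ≤ C * ((1 + 16 * t) * ((1 + |s|) / 2) ^ (-β)) := by
          refine h5.trans ?_
          exact mul_le_mul_of_nonneg_left (h6.trans (by gcongr)) hC.le
      _ ≤ _ := by linarith

lemma integrable_gammaPsi_pow {α β t : ℝ} (hα : 0 < α) (hβ0 : 0 < β) (hβ : β < 1)
    (hβα : β ≤ α) (ht : 0 < t) {n : ℕ} (hn : 1 < n * β) :
    Integrable (fun s : ℝ => gammaPsi α s t ^ n) := by
  obtain ⟨C, hC, h⟩ := exists_norm_gammaPsi_le_one_add_abs hα hβ0 hβ hβα ht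
  have hi : Integrable (fun s : ℝ => C ^ n * (1 + ‖s‖) ^ (-(n * β))) :=
    (integrable_one_add_norm (by simpa using hn)).const_mul _
  refine Integrable.mono' hi ((continuous_gammaPsi hα ht).pow n).aestronglyMeasurable
    (ae_of_all _ fun s => ?_)
  rw [norm_pow]
  calc _ ≤ (C * (1 + |s|) ^ (-β)) ^ n := by gcongr; exact h s
    _ = _ := by
      rw [mul_pow, ← Real.rpow_natCast ((1 + |s|) ^ (-β)), ← Real.rpow_mul (by positivity),
        Real.norm_eq_abs]
      ring_nf

/-- Joint decay of powers of the characteristic function. -/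
lemma exists_norm_gammaPsi_pow_le {α β t₁ : ℝ} (hα : 0 < α) (hβ0 : 0 < β) (hβ : β < 1)
    (hβα : β ≤ α) (ht₁ : 0 < t₁) {n : ℕ} (hn : 3 < n * β) :
    ∃ C : ℝ, 0 < C ∧ ∀ s t : ℝ, t₁ ≤ t →
      ‖gammaPsi α s t‖ ^ n ≤ C * (t ^ (-(1 / 9) : ℝ) * (1 + |s|) ^ (-(10 / 9) : ℝ)) := by
  obtain ⟨C₁, hC₁, h₁⟩ := exists_norm_gammaPsi_le_rpow hα hβ0 hβ hβα
  obtain ⟨C₂, hC₂, h₂⟩ := exists_norm_gammaPsi_le_rpow_add_exp hα hβ0 hβ hβα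
  set κ := t₁ / (1 + t₁) with hκ
  have hκ0 : 0 < κ := by positivity
  set A := (C₁ * κ ^ (-(β / 2))) ^ n with hA
  -- Here 120 = 5!; the constant comes from exp(y) ≥ y⁵/5! at y = v^(1/5)/16.
  set K : ℝ := 120 * 16 ^ 5
  set B := (C₂ * (1 + K)) ^ n with hB
  refine ⟨(A + B) * 2 ^ (10 / 9 : ℝ), by positivity, fun s t ht => ?_⟩
  have ht0 : 0 < t := ht₁.trans_le ht
  set u := 1 + t with hu
  have hu1 : 1 ≤ u := by linarith
  have hu0 : 0 < u := by linarith
  set w := 1 + |s| with hw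
  have hw1 : 1 ≤ w := by have := abs_nonneg s; linarith
  have hw0 : 0 < w := by linarith
  have hut : u ^ (-(1 / 9) : ℝ) ≤ t ^ (-(1 / 9) : ℝ) :=
    Real.rpow_le_rpow_of_nonpos ht0 (by linarith) (by norm_num)
  have hv2 : (w / 2) ^ (-(10 / 9) : ℝ) = 2 ^ (10 / 9 : ℝ) * w ^ (-(10 / 9) : ℝ) := by
    rw [Real.div_rpow hw0.le two_pos.le, Real.rpow_neg two_pos.le, div_inv_eq_mul, mul_comm]
  have hfin : ∀ D, 0 ≤ D → D ≤ A + B → D * (u ^ (-(1 / 9) : ℝ) * (w / 2) ^ (-(10 / 9) : ℝ)) ≤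
      (A + B) * 2 ^ (10 / 9 : ℝ) * (t ^ (-(1 / 9) : ℝ) * w ^ (-(10 / 9) : ℝ)) := by
    intro D hD hDA
    calc _ ≤ (A + B) * (t ^ (-(1 / 9) : ℝ) * (w / 2) ^ (-(10 / 9) : ℝ)) := by gcongr
      _ = _ := by rw [hv2]; ring
  have hA0 : 0 ≤ A := by positivity
  have hB0 : 0 ≤ B := by positivity
  -- If w/2 ≤ u^(5/4), decay in t gives u^(-3/2), and 3/2 = 1/9 + (5/4)(10/9). Otherwise |s|/t is at
  -- least a fifth root of v = w/2, the exponential is negligible, and decay in s gives v^(-3).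
  rcases le_or_gt (w / 2) (u ^ (5 / 4 : ℝ)) with hcase | hcase
  · refine le_trans ?_ (hfin A hA0 (by linarith))
    have e1 : κ * u ≤ t := by
      rw [hκ, div_mul_eq_mul_div, div_le_iff₀ (by positivity)]
      nlinarith
    have e2 : t ^ (-(β / 2)) ≤ κ ^ (-(β / 2)) * u ^ (-(β / 2)) := by
      rw [← Real.mul_rpow hκ0.le hu0.le]
      exact Real.rpow_le_rpow_of_nonpos (by positivity) e1 (by linarith)
    have e3 : (u ^ (-(β / 2))) ^ n ≤ u ^ (-(3 / 2) : ℝ) := by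
      rw [← Real.rpow_natCast, ← Real.rpow_mul hu0.le]
      exact Real.rpow_le_rpow_of_exponent_le hu1 (by linarith)
    have e4 : u ^ (-(3 / 2) : ℝ) ≤ u ^ (-(1 / 9) : ℝ) * (w / 2) ^ (-(10 / 9) : ℝ) := by
      have : (u ^ (5 / 4 : ℝ)) ^ (-(10 / 9) : ℝ) ≤ (w / 2) ^ (-(10 / 9) : ℝ) :=
        Real.rpow_le_rpow_of_nonpos (by positivity) hcase (by norm_num)
      rw [← Real.rpow_mul hu0.le] at this
      calc _ = u ^ (-(1 / 9) : ℝ) * u ^ ((5 / 4 : ℝ) * (-(10 / 9))) := by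
            rw [← Real.rpow_add hu0]; norm_num
        _ ≤ _ := by gcongr
    calc _ ≤ (C₁ * (κ ^ (-(β / 2)) * u ^ (-(β / 2)))) ^ n := by
          gcongr
          exact (h₁ s t ht0).trans (by gcongr)
      _ = A * (u ^ (-(β / 2))) ^ n := by rw [hA, ← mul_pow]; ring
      _ ≤ _ := by gcongr; exact e3.trans e4
  · refine le_trans ?_ (hfin B hB0 (by linarith))
    set v := w / 2 with hv
    have huv : u ≤ v := by
      refine le_trans ?_ hcase.le
      simpa using Real.rpow_le_rpow_of_exponent_le hu1 (show (1 : ℝ) ≤ 5 / 4 by norm_num)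
    have hv1 : 1 ≤ v := hu1.trans huv
    have hv0 : 0 < v := by linarith
    have hsv : v ≤ |s| := by linarith
    have hs0 : 0 < |s| := hv0.trans_le hsv
    have e1 : |s| ^ (-β) ≤ v ^ (-β) := Real.rpow_le_rpow_of_nonpos hv0 hsv (by linarith)
    have e2 : t ≤ v ^ (4 / 5 : ℝ) := by
      have h3 : (u ^ (5 / 4 : ℝ)) ^ (4 / 5 : ℝ) ≤ v ^ (4 / 5 : ℝ) :=
        Real.rpow_le_rpow (by positivity) hcase.le (by norm_num)
      rw [← Real.rpow_mul hu0.le] at h3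
      norm_num at h3
      linarith
    have e3 : v ^ (1 / 5 : ℝ) / 16 ≤ |s| / (16 * t) := by
      rw [div_le_div_iff₀ (by norm_num) (by positivity)]
      have h3 : v ^ (1 / 5 : ℝ) * t ≤ v ^ (1 / 5 : ℝ) * v ^ (4 / 5 : ℝ) := by gcongr
      rw [← Real.rpow_add hv0] at h3
      norm_num at h3
      linarith
    have e4 : Real.exp (-(|s| / (16 * t))) ≤ K * v ^ (-β) := by
      have h3 := Real.pow_div_factorial_le_exp (v ^ (1 / 5 : ℝ) / 16) (by positivity) 5
      have h4 : (v ^ (1 / 5 : ℝ) / 16) ^ 5 / (Nat.factorial 5 : ℝ) = v / K := by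
        rw [div_pow, ← Real.rpow_natCast, ← Real.rpow_mul hv0.le]
        norm_num [Nat.factorial, K]
        ring
      rw [h4] at h3
      have h5 : v ^ β ≤ v := by simpa using Real.rpow_le_rpow_of_exponent_le hv1 hβ.le
      rw [Real.exp_neg, Real.rpow_neg hv0.le, ← div_eq_mul_inv,
        inv_le_comm₀ (Real.exp_pos _) (by positivity), inv_div]
      refine le_trans ?_ (h3.trans (Real.exp_le_exp.2 e3))
      gcongr
    have e5 : ‖gammaPsi α s t‖ ≤ C₂ * (1 + K) * v ^ (-β) := by
      refine (h₂ s t (abs_pos.1 hs0) ht0).trans ?_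
      rw [mul_assoc]
      gcongr
      linarith
    have e6 : (v ^ (-β)) ^ n ≤ v ^ (-(1 / 9) : ℝ) * v ^ (-(10 / 9) : ℝ) := by
      rw [← Real.rpow_natCast, ← Real.rpow_mul hv0.le, ← Real.rpow_add hv0]
      exact Real.rpow_le_rpow_of_exponent_le hv1 (by linarith)
    have e7 : v ^ (-(1 / 9) : ℝ) ≤ u ^ (-(1 / 9) : ℝ) :=
      Real.rpow_le_rpow_of_nonpos hu0 huv (by norm_num)
    calc _ ≤ (C₂ * (1 + K) * v ^ (-β)) ^ n := by gcongr
      _ = B * (v ^ (-β)) ^ n := by rw [hB, ← mul_pow]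
      _ ≤ B * (v ^ (-(1 / 9) : ℝ) * v ^ (-(10 / 9) : ℝ)) := by gcongr
      _ ≤ _ := by gcongr

/-! ### Independence of the sum and the scale invariant ratio -/

lemma lintegral_gammaMeasure_one {b : ℝ} {f : ℝ → ENNReal} (hf : Measurable f) :
    ∫⁻ x, f x ∂(gammaMeasure b 1) = ∫⁻ x in Set.Ioi (0 : ℝ),
      ENNReal.ofReal (x ^ (b - 1) * Real.exp (-x) / Real.Gamma b) * f x := by
  rw [gammaMeasure_one_eq_withDensity, lintegral_withDensity_eq_lintegral_mul _ (by fun_prop) hf]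
  rfl

lemma ae_gammaMeasure_one_pos (b : ℝ) : ∀ᵐ x ∂(gammaMeasure b 1), 0 < x := by
  rw [gammaMeasure_one_eq_withDensity]
  exact (withDensity_absolutelyContinuous _ _).ae_le (ae_restrict_mem measurableSet_Ioi)

lemma lintegral_Ioi_comp_mul_left {c : ℝ} (hc : 0 < c) (g : ℝ → ENNReal) :
    ∫⁻ x in Set.Ioi (0 : ℝ), ENNReal.ofReal c * g (c * x) = ∫⁻ x in Set.Ioi (0 : ℝ), g x := by
  have him : (fun x => c * x) '' Set.Ioi (0 : ℝ) = Set.Ioi 0 := by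
    rw [Set.image_mul_left_Ioi hc, mul_zero]
  have h := lintegral_image_eq_lintegral_abs_deriv_mul (f' := fun _ => c)
    (s := Set.Ioi (0 : ℝ)) measurableSet_Ioi
    (fun x _ => by simpa using ((hasDerivAt_id x).const_mul c).hasDerivWithinAt)
    ((mul_right_injective₀ hc.ne').injOn) g
  rw [him] at h
  simp_rw [abs_of_pos hc] at h
  exact h.symm

lemma lintegral_Ioi_comp_const_div {c : ℝ} (hc : 0 < c) (g : ℝ → ENNReal) :
    ∫⁻ x in Set.Ioi (0 : ℝ), ENNReal.ofReal (c / x ^ 2) * g (c / x) =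
      ∫⁻ x in Set.Ioi (0 : ℝ), g x := by
  have him : (fun x => c / x) '' Set.Ioi (0 : ℝ) = Set.Ioi 0 := by
    ext y
    constructor
    · rintro ⟨x, hx, rfl⟩
      exact div_pos hc hx
    · intro hy
      exact ⟨c / y, div_pos hc hy, div_div_cancel₀ hc.ne'⟩
  have h := lintegral_image_eq_lintegral_abs_deriv_mul (f := fun x => c / x)
    (f' := fun x => -(c / x ^ 2)) measurableSet_Ioi
    (fun x (hx : 0 < x) => by
      have := ((hasDerivAt_inv hx.ne').const_mul c).hasDerivWithinAt (s := Set.Ioi 0)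
      simp only [← div_eq_mul_inv] at this
      exact this.congr_deriv (by ring))
    (fun x (hx : 0 < x) y (hy : 0 < y) hxy => by
      simp only at hxy
      rw [div_eq_div_iff hx.ne' hy.ne'] at hxy
      exact (mul_left_cancel₀ hc.ne' hxy).symm) g
  rw [him] at h
  rw [h]
  refine setLIntegral_congr_fun measurableSet_Ioi fun x hx => ?_
  rw [abs_neg, abs_of_pos (div_pos hc (pow_pos hx 2))]

/-- Scaling of the gamma law by exponential tilting. -/
lemma lintegral_gammaMeasure_tilt {α c : ℝ} (hα : 0 < α) (hc : 0 < c) {f : ℝ → ENNReal}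
    (hf : Measurable f) :
    ∫⁻ x, f (c * x) * ENNReal.ofReal (c ^ α * Real.exp (-((c - 1) * x))) ∂(gammaMeasure α 1) =
      ∫⁻ x, f x ∂(gammaMeasure α 1) := by
  have hG := Real.Gamma_pos_of_pos hα
  rw [lintegral_gammaMeasure_one hf, lintegral_gammaMeasure_one (by fun_prop),
    ← lintegral_Ioi_comp_mul_left hc (fun x =>
      ENNReal.ofReal (x ^ (α - 1) * Real.exp (-x) / Real.Gamma α) * f x)]
  refine setLIntegral_congr_fun measurableSet_Ioi fun x hx => ?_
  have hx : 0 < x := hx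
  have e : x ^ (α - 1) * Real.exp (-x) / Real.Gamma α * (c ^ α * Real.exp (-((c - 1) * x))) =
      c * ((c * x) ^ (α - 1) * Real.exp (-(c * x)) / Real.Gamma α) := by
    rw [Real.mul_rpow hc.le hx.le, show -(c * x) = -x + -((c - 1) * x) by ring, Real.exp_add,
      show c ^ α = c * c ^ (α - 1) by rw [Real.rpow_sub_one hc.ne']; field_simp]
    ring
  rw [← mul_assoc (ENNReal.ofReal c), ← ENNReal.ofReal_mul hc.le, ← e,
    ENNReal.ofReal_mul (gammaDensity_nonneg hα hx)]
  ring

/-- Scaling of a product of gamma laws by exponential tilting. -/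
lemma lintegral_pi_gammaMeasure_tilt {ι : Type*} [Fintype ι] {α c : ℝ} (hα : 0 < α) (hc : 0 < c)
    {f : (ι → ℝ) → ENNReal} (hf : Measurable f) :
    ∫⁻ x, f (c • x) * ∏ i, ENNReal.ofReal (c ^ α * Real.exp (-((c - 1) * x i)))
      ∂(Measure.pi fun _ : ι => gammaMeasure α 1) =
      ∫⁻ x, f x ∂(Measure.pi fun _ : ι => gammaMeasure α 1) := by
  have := isProbabilityMeasure_gammaMeasure hα one_pos
  set μ := Measure.pi fun _ : ι => gammaMeasure α 1 with hμ
  set r : ℝ → ENNReal := fun x => ENNReal.ofReal (c ^ α * Real.exp (-((c - 1) * x))) with hr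
  have hrm : Measurable r := by fun_prop
  have hm : Measurable (fun x : ι → ℝ => ∏ i, r (x i)) :=
    Finset.measurable_prod _ fun i _ => hrm.comp (measurable_pi_apply i)
  have hsm : Measurable (fun x : ι → ℝ => c • x) := by fun_prop
  -- A product measure is determined by its values on boxes, where the weighted integral factors
  -- into the one-dimensional tilts.
  have key : μ = (μ.withDensity fun x => ∏ i, r (x i)).map (fun x => c • x) := by
    refine Measure.pi_eq fun s hs => ?_
    rw [Measure.map_apply hsm (MeasurableSet.univ_pi hs),
      withDensity_apply _ (hsm (MeasurableSet.univ_pi hs)),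
      ← lintegral_indicator (hsm (MeasurableSet.univ_pi hs))]
    have hfm : ∀ i, Measurable fun y : ℝ => (s i).indicator 1 (c * y) * r y := fun i =>
      ((measurable_one.indicator (hs i)).comp (measurable_const_mul c)).mul hrm
    have e : ∀ x : ι → ℝ, ((fun x : ι → ℝ => c • x) ⁻¹' Set.univ.pi s).indicator
        (fun x => ∏ i, r (x i)) x = ∏ i, ((s i).indicator 1 (c * x i) * r (x i)) := by
      intro x
      by_cases hx : ∀ i, c * x i ∈ s i
      · rw [Set.indicator_of_mem (by simpa using hx)]
        exact Finset.prod_congr rfl fun i _ => by simp [hx i]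
      · rw [Set.indicator_of_notMem (by simpa using hx)]
        push Not at hx
        obtain ⟨i, hi⟩ := hx
        exact (Finset.prod_eq_zero (Finset.mem_univ i) (by simp [hi])).symm
    simp_rw [e]
    have hind : iIndepFun (fun (i : ι) (x : ι → ℝ) => (s i).indicator 1 (c * x i) * r (x i)) μ :=
      iIndepFun_pi (X := fun i y => (s i).indicator 1 (c * y) * r y)
        fun i => (hfm i).aemeasurable
    rw [lintegral_prod_eq_prod_lintegral_of_indepFun Finset.univ _ hind
      fun i => (hfm i).comp (measurable_pi_apply i)]
    refine Finset.prod_congr rfl fun i _ => ?_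
    have h1 : ∫⁻ x : ι → ℝ, (s i).indicator 1 (c * x i) * r (x i) ∂μ =
        ∫⁻ y, (s i).indicator 1 (c * y) * r y ∂(gammaMeasure α 1) :=
      (measurePreserving_eval (fun _ : ι => gammaMeasure α 1) i).lintegral_comp (hfm i)
    rw [h1, lintegral_gammaMeasure_tilt hα hc (measurable_one.indicator (hs i)),
      lintegral_indicator_one (hs i)]
  conv_rhs => rw [key]
  have h := lintegral_withDensity_eq_lintegral_mul μ hm (hf.comp hsm)
  simp only [Function.comp_def] at h
  rw [lintegral_map hf hsm, h]
  refine lintegral_congr fun x => ?_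
  rw [Pi.mul_apply, mul_comm]

/-- The ratio of the sum of squares to the square of the sum. -/
noncomputable def sumSqRatio {ι : Type*} [Fintype ι] (x : ι → ℝ) : ℝ :=
  (∑ i, x i ^ 2) / (∑ i, x i) ^ 2

@[fun_prop]
lemma measurable_sumSqRatio {ι : Type*} [Fintype ι] :
    Measurable (sumSqRatio : (ι → ℝ) → ℝ) := by
  unfold sumSqRatio
  fun_prop

lemma sumSqRatio_smul {ι : Type*} [Fintype ι] {c : ℝ} (hc : c ≠ 0) (x : ι → ℝ) :
    sumSqRatio (c • x) = sumSqRatio x := by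
  simp only [sumSqRatio, Pi.smul_apply, smul_eq_mul, mul_pow, ← Finset.mul_sum]
  rw [mul_div_mul_left _ _ (pow_ne_zero 2 hc)]

lemma ae_pi_gammaMeasure_pos {ι : Type*} [Fintype ι] {α : ℝ} (hα : 0 < α) :
    ∀ᵐ x ∂(Measure.pi fun _ : ι => gammaMeasure α 1), ∀ i, 0 < x i := by
  have := isProbabilityMeasure_gammaMeasure hα one_pos
  exact ae_all_iff.2 fun i => Measure.tendsto_eval_ae_ae.eventually (ae_gammaMeasure_one_pos α)

/-- The integrand is the density of c/Y for Y gamma of shape a. -/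
lemma lintegral_gammaDensity_const_div {a c : ℝ} (ha : 0 < a) (hc : 0 < c) :
    ∫⁻ l in Set.Ioi (0 : ℝ), ENNReal.ofReal ((c / l) ^ a * Real.exp (-(c / l)) /
      (l * Real.Gamma a)) = 1 := by
  have := isProbabilityMeasure_gammaMeasure ha one_pos
  have h := lintegral_gammaMeasure_one (b := a) (f := fun _ => 1) measurable_const
  rw [lintegral_one, measure_univ, ← lintegral_Ioi_comp_const_div hc] at h
  rw [h]
  refine setLIntegral_congr_fun measurableSet_Ioi fun l hl => ?_
  have hl : 0 < l := hl
  rw [mul_one, ← ENNReal.ofReal_mul (by positivity), Real.rpow_sub_one (by positivity)]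
  congr 1
  field_simp

/-- For independent gamma variables the sum is independent of the scale invariant ratio, and its
law is a gamma law. -/
lemma lintegral_sum_sumSqRatio {ι : Type*} [Fintype ι] [Nonempty ι] {α : ℝ} (hα : 0 < α)
    {G : ℝ × ℝ → ENNReal} (hG : Measurable G) :
    ∫⁻ x, G (∑ i, x i, sumSqRatio x) ∂(Measure.pi fun _ : ι => gammaMeasure α 1) =
      ∫⁻ x, ∫⁻ y, G (y, sumSqRatio x) ∂(gammaMeasure (α * Fintype.card ι) 1)
        ∂(Measure.pi fun _ : ι => gammaMeasure α 1) := by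
  have := isProbabilityMeasure_gammaMeasure hα one_pos
  set μ := Measure.pi fun _ : ι => gammaMeasure α 1 with hμ
  set a := α * Fintype.card ι with ha
  have ha0 : 0 < a := by positivity
  have hΓ := Real.Gamma_pos_of_pos ha0
  set k : ℝ → ℝ → ENNReal := fun c l => ENNReal.ofReal ((c / l) ^ a * Real.exp (-(c / l)) /
      (l * Real.Gamma a)) with hk
  have hpos : ∀ᵐ x ∂μ, 0 < ∑ i, x i := by
    filter_upwards [ae_pi_gammaMeasure_pos hα] with x hx
    exact Finset.sum_pos (fun i _ => hx i) Finset.univ_nonempty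
  calc ∫⁻ x, G (∑ i, x i, sumSqRatio x) ∂μ
      = ∫⁻ x, (∫⁻ l in Set.Ioi (0 : ℝ), G (∑ i, x i, sumSqRatio x) * k (∑ i, x i) l) ∂μ := by
        -- Insert the kernel k(S, l), which integrates to one in l because S > 0 almost surely.
        refine lintegral_congr_ae ?_
        filter_upwards [hpos] with x hx
        rw [lintegral_const_mul _ (by fun_prop), lintegral_gammaDensity_const_div ha0 hx, mul_one]
    _ = ∫⁻ l in Set.Ioi (0 : ℝ), (∫⁻ x, G (∑ i, x i, sumSqRatio x) * k (∑ i, x i) l ∂μ) :=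
        lintegral_lintegral_swap (by fun_prop)
    _ = ∫⁻ l in Set.Ioi (0 : ℝ), ∫⁻ x, ENNReal.ofReal (∑ i, x i) *
          (ENNReal.ofReal (((∑ i, x i) * l) ^ (a - 1) * Real.exp (-((∑ i, x i) * l)) /
            Real.Gamma a) * G ((∑ i, x i) * l, sumSqRatio x)) ∂μ := by
        refine setLIntegral_congr_fun measurableSet_Ioi fun l hl => ?_
        have hl : 0 < l := hl
        -- Rescaling x by l fixes the ratio and sends S to lS; the tilt l^a exp(-(l-1)S) depends on
        -- S alone, and with k(lS, l) it makes S times the gamma density at lS. In the variable y =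
        -- lS the sum is then integrated out.
        rw [← lintegral_pi_gammaMeasure_tilt hα hl (by fun_prop)]
        refine lintegral_congr_ae ?_
        filter_upwards [hpos] with x hx
        rw [sumSqRatio_smul hl.ne']
        simp only [Pi.smul_apply, smul_eq_mul, ← Finset.mul_sum]
        rw [← ENNReal.ofReal_prod_of_nonneg (fun i _ => by positivity), Finset.prod_mul_distrib,
          Finset.prod_const, ← Real.exp_sum, Finset.sum_neg_distrib, ← Finset.mul_sum,
          Finset.card_univ, ← Real.rpow_natCast, ← Real.rpow_mul hl.le, ← ha, mul_assoc,
          ← ENNReal.ofReal_mul (by positivity), ← mul_assoc (ENNReal.ofReal _),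
          ← ENNReal.ofReal_mul hx.le, mul_comm, mul_comm l]
        congr 2
        rw [mul_div_cancel_right₀ _ hl.ne', Real.rpow_sub_one (by positivity),
          Real.mul_rpow hx.le hl.le,
          show -((∑ i, x i) * l) = -(∑ i, x i) + -((l - 1) * ∑ i, x i) by ring, Real.exp_add]
        field_simp
    _ = ∫⁻ x, (∫⁻ l in Set.Ioi (0 : ℝ), ENNReal.ofReal (∑ i, x i) *
          (ENNReal.ofReal (((∑ i, x i) * l) ^ (a - 1) * Real.exp (-((∑ i, x i) * l)) /
            Real.Gamma a) * G ((∑ i, x i) * l, sumSqRatio x))) ∂μ :=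
        lintegral_lintegral_swap (by fun_prop)
    _ = _ := by
        refine lintegral_congr_ae ?_
        filter_upwards [hpos] with x hx
        rw [lintegral_gammaMeasure_one (by fun_prop), ← lintegral_Ioi_comp_mul_left hx (fun y =>
          ENNReal.ofReal (y ^ (a - 1) * Real.exp (-y) / Real.Gamma a) * G (y, sumSqRatio x))]

lemma map_sum_sumSqRatio {ι : Type*} [Fintype ι] [Nonempty ι] {α : ℝ} (hα : 0 < α) :
    (Measure.pi fun _ : ι => gammaMeasure α 1).map (fun x => (∑ i, x i, sumSqRatio x)) =
      (gammaMeasure (α * Fintype.card ι) 1).prod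
        ((Measure.pi fun _ : ι => gammaMeasure α 1).map sumSqRatio) := by
  have := isProbabilityMeasure_gammaMeasure hα one_pos
  have ha : 0 < α * Fintype.card ι := by positivity
  have := isProbabilityMeasure_gammaMeasure ha one_pos
  refine Measure.ext_of_lintegral _ fun f hf => ?_
  rw [lintegral_map hf (by fun_prop), lintegral_sum_sumSqRatio hα hf,
    lintegral_prod_symm _ hf.aemeasurable, lintegral_map (Measurable.lintegral_prod_left' hf)
    measurable_sumSqRatio]

/-! ### Law of the ratio and Fourier inversion -/

/-- The law of the ratio of the sum of squares to the square of the sum of `n` independent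
gamma variables. -/
noncomputable def ratioLaw (α : ℝ) (n : ℕ) : Measure ℝ :=
  (Measure.pi fun _ : Fin n => gammaMeasure α 1).map sumSqRatio

lemma isProbabilityMeasure_ratioLaw {α : ℝ} (hα : 0 < α) (n : ℕ) :
    IsProbabilityMeasure (ratioLaw α n) := by
  have := isProbabilityMeasure_gammaMeasure hα one_pos
  exact Measure.isProbabilityMeasure_map (by fun_prop)

lemma norm_cexp_I_mul_ofReal (x : ℝ) : ‖exp (I * x)‖ = 1 := by
  rw [mul_comm, Complex.norm_exp_ofReal_mul_I]

lemma continuous_integral_cexp {ν : Measure ℝ} [IsProbabilityMeasure ν] :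
    Continuous (fun u : ℝ => ∫ v, exp (I * ((u * v : ℝ) : ℂ)) ∂ν) := by
  refine continuous_of_dominated (bound := fun _ => 1) (fun u => by fun_prop)
    (fun u => ae_of_all _ fun v => (norm_cexp_I_mul_ofReal _).le)
    (integrable_const _) (ae_of_all _ fun v => by fun_prop)

lemma norm_integral_cexp_le_one {ν : Measure ℝ} [IsProbabilityMeasure ν] (u : ℝ) :
    ‖∫ v, exp (I * ((u * v : ℝ) : ℂ)) ∂ν‖ ≤ 1 :=
  (norm_integral_le_of_norm_le_const (C := 1)
    (ae_of_all _ fun v => (norm_cexp_I_mul_ofReal _).le)).trans (by simp)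

/-- The characteristic function of the sum and the sum of squares, by conditioning on the sum. -/
lemma gammaPsi_pow_eq_integral {α : ℝ} (hα : 0 < α) {n : ℕ} (hn : 0 < n) (s : ℝ) {t : ℝ}
    (ht : 0 < t) :
    gammaPsi α s t ^ n = ∫ y, exp (I * ((s * y : ℝ) : ℂ)) *
      ∫ v, exp (I * ((t * y ^ 2 * v : ℝ) : ℂ)) ∂(ratioLaw α n) ∂(gammaMeasure (α * n) 1) := by
  have := isProbabilityMeasure_gammaMeasure hα one_pos
  have hn' : (0 : ℝ) < n := by exact_mod_cast hn
  have := isProbabilityMeasure_gammaMeasure (mul_pos hα hn') one_pos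
  have := isProbabilityMeasure_ratioLaw hα n
  have : Nonempty (Fin n) := ⟨⟨0, hn⟩⟩
  have h1 := integral_fintype_prod_eq_prod (ι := Fin n) (μ := fun _ => gammaMeasure α 1)
    (fun (_ : Fin n) (x : ℝ) => exp (I * s * x + I * t * (x : ℂ) ^ 2))
  simp only [integral_gammaMeasure_cexp_eq_gammaPsi hα s ht, Finset.prod_const, Finset.card_univ,
    Fintype.card_fin] at h1
  have h2 : ∫ x : Fin n → ℝ, ∏ i, exp (I * s * x i + I * t * (x i : ℂ) ^ 2)
      ∂(Measure.pi fun _ => gammaMeasure α 1) =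
      ∫ x : Fin n → ℝ, (fun p : ℝ × ℝ => exp (I * ((s * p.1 : ℝ) : ℂ)) *
        exp (I * ((t * p.1 ^ 2 * p.2 : ℝ) : ℂ))) (∑ i, x i, sumSqRatio x)
      ∂(Measure.pi fun _ => gammaMeasure α 1) := by
    refine integral_congr_ae ?_
    filter_upwards [ae_pi_gammaMeasure_pos hα] with x hx
    have hS : 0 < ∑ i, x i := Finset.sum_pos (fun i _ => hx i) Finset.univ_nonempty
    have hQ : (∑ i, x i) ^ 2 * sumSqRatio x = ∑ i, x i ^ 2 := by
      rw [sumSqRatio, mul_div_cancel₀ _ (pow_ne_zero 2 hS.ne')]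
    rw [← Complex.exp_sum, ← Complex.exp_add]
    congr 1
    rw [mul_assoc t, hQ, Finset.sum_add_distrib, ← Finset.mul_sum, ← Finset.mul_sum]
    push_cast
    ring
  have h3 := integral_map (μ := Measure.pi fun _ : Fin n => gammaMeasure α 1)
    (φ := fun x : Fin n → ℝ => (∑ i, x i, sumSqRatio x)) (by fun_prop)
    (f := fun p : ℝ × ℝ => exp (I * ((s * p.1 : ℝ) : ℂ)) *
        exp (I * ((t * p.1 ^ 2 * p.2 : ℝ) : ℂ))) (by fun_prop)
  rw [← h1, h2, ← h3, map_sum_sumSqRatio hα, Fintype.card_fin, ← ratioLaw, integral_prod]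
  · simp_rw [integral_const_mul]
  · refine Integrable.mono' (integrable_const (1 : ℝ)) (by fun_prop) (ae_of_all _ fun p => ?_)
    rw [norm_mul, norm_cexp_I_mul_ofReal, norm_cexp_I_mul_ofReal, mul_one]

/-- Fourier inversion in the linear variable gives the conditional characteristic function of the
sum of squares. -/
lemma integral_gammaPsi_pow_mul_cexp {α : ℝ} (hα : 0 < α) {n : ℕ} (hn : 0 < n) {t m : ℝ}
    (ht : 0 < t) (hm : 0 < m) (hint : Integrable (fun s : ℝ => gammaPsi α s t ^ n)) :
    ∫ s : ℝ, gammaPsi α s t ^ n * exp (-(I * ((m * s : ℝ) : ℂ))) =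
      ((2 * Real.pi * (m ^ (α * n - 1) * Real.exp (-m) / Real.Gamma (α * n)) : ℝ) : ℂ) *
        ∫ v, exp (I * ((t * m ^ 2 * v : ℝ) : ℂ)) ∂(ratioLaw α n) := by
  have hn' : (0 : ℝ) < n := by exact_mod_cast hn
  have ha : 0 < α * n := mul_pos hα hn'
  have := isProbabilityMeasure_gammaMeasure ha one_pos
  have := isProbabilityMeasure_ratioLaw hα n
  set h : ℝ → ℂ := fun u => ∫ v, exp (I * ((u * v : ℝ) : ℂ)) ∂(ratioLaw α n) with hh
  have hcont : Continuous h := continuous_integral_cexp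
  have hψ : ∀ s : ℝ, gammaPsi α s t ^ n = ∫ y, exp (I * ((s * y : ℝ) : ℂ)) * h (t * y ^ 2)
      ∂(gammaMeasure (α * n) 1) := fun s => gammaPsi_pow_eq_integral hα hn s ht
  set d : ℝ → ℝ := fun y => y ^ (α * n - 1) * Real.exp (-y) / Real.Gamma (α * n) with hd
  set g : ℝ → ℂ := (Set.Ioi (0 : ℝ)).indicator fun y => d y • h (t * y ^ 2) with hg
  have hgint : Integrable g := by
    rw [hg, integrable_indicator_iff measurableSet_Ioi, ← integrable_gammaMeasure_one_iff ha]
    refine Integrable.mono' (integrable_const (1 : ℝ)) (by fun_prop) (ae_of_all _ fun y => ?_)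
    exact norm_integral_cexp_le_one _
  -- The normalization exp(-2πiwy) of the Fourier transform makes the frequency s = -2πw.
  have hF : ∀ w : ℝ, FourierTransform.fourier g w = gammaPsi α (-(2 * Real.pi) * w) t ^ n := by
    intro w
    rw [Real.fourier_real_eq_integral_exp_smul, hψ, integral_gammaMeasure_one ha,
      ← integral_indicator measurableSet_Ioi]
    refine integral_congr_ae (ae_of_all _ fun y => ?_)
    beta_reduce
    by_cases hy : y ∈ Set.Ioi (0 : ℝ)
    · rw [hg, Set.indicator_of_mem hy, Set.indicator_of_mem hy, smul_comm, smul_eq_mul]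
      congr 3
      push_cast
      ring
    · rw [hg, Set.indicator_of_notMem hy, Set.indicator_of_notMem hy, smul_zero]
  have hFint : Integrable (FourierTransform.fourier g) := by
    rw [show FourierTransform.fourier g = fun w => gammaPsi α (-(2 * Real.pi) * w) t ^ n from
      funext hF]
    exact hint.comp_mul_left' (by simp [Real.pi_ne_zero])
  have hgm : g m = d m • h (t * m ^ 2) := Set.indicator_of_mem hm _
  have hgc : ContinuousAt g m := by
    have h1 : ContinuousAt (fun y => d y • h (t * y ^ 2)) m := by
      have h2 : Continuous fun y : ℝ => h (t * y ^ 2) := hcont.comp (by fun_prop)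
      have h3 : ContinuousAt d m :=
        ((Real.continuousAt_rpow_const _ _ (Or.inl hm.ne')).mul (by fun_prop)).div_const _
      exact h3.smul h2.continuousAt
    refine h1.congr ?_
    filter_upwards [Ioi_mem_nhds hm] with y hy
    exact (Set.indicator_of_mem hy fun y => d y • h (t * y ^ 2)).symm
  have hinv := hgint.fourierInv_fourier_eq hFint hgc
  rw [Real.fourierInv_eq', hgm] at hinv
  have e : ∫ w : ℝ, exp (((2 * Real.pi * inner ℝ w m : ℝ) : ℂ) * I) • FourierTransform.fourier g w =
      ∫ w : ℝ, (fun s : ℝ => gammaPsi α s t ^ n * exp (-(I * ((m * s : ℝ) : ℂ))))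
        (-(2 * Real.pi) * w) := by
    refine integral_congr_ae (ae_of_all _ fun w => ?_)
    beta_reduce
    rw [hF, smul_eq_mul, mul_comm]
    congr 2
    simp
    ring
  have hsub := Measure.integral_comp_mul_left
    (fun s : ℝ => gammaPsi α s t ^ n * exp (-(I * ((m * s : ℝ) : ℂ)))) (-(2 * Real.pi))
  rw [e, hsub] at hinv
  have h2π : |(-(2 * Real.pi))⁻¹| = (2 * Real.pi)⁻¹ := by
    rw [abs_inv, abs_neg, abs_of_pos Real.two_pi_pos]
  rw [h2π, inv_smul_eq_iff₀ Real.two_pi_pos.ne'] at hinv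
  rw [hinv, smul_smul, real_smul]

/-! ### Absence of atoms and support of the ratio -/

/-- A polynomial of degree at most two in x; when c = 1 its leading coefficient vanishes but the
linear one is -2T ≠ 0. -/
lemma finite_setOf_quadratic_ratio_eq {c T W : ℝ} (hT : T ≠ 0) :
    {x : ℝ | x ^ 2 + W = c * (x + T) ^ 2}.Finite := by
  set p : Polynomial ℝ := Polynomial.C (1 - c) * Polynomial.X ^ 2 +
    Polynomial.C (-(2 * c * T)) * Polynomial.X + Polynomial.C (W - c * T ^ 2) with hp
  have hp0 : p ≠ 0 := by
    intro h0
    have h2 : p.coeff 2 = 1 - c := by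
      simp only [hp, Polynomial.coeff_add, Polynomial.coeff_C_mul, Polynomial.coeff_X_pow,
        Polynomial.coeff_X, Polynomial.coeff_C]
      norm_num
    have h1 : p.coeff 1 = -(2 * c * T) := by
      simp only [hp, Polynomial.coeff_add, Polynomial.coeff_C_mul, Polynomial.coeff_X_pow,
        Polynomial.coeff_X, Polynomial.coeff_C]
      norm_num
    rw [h0, Polynomial.coeff_zero] at h1 h2
    have hc : c = 1 := by linarith
    rw [hc] at h1
    exact hT (by linarith)
  refine (Polynomial.finite_setOfPred_isRoot hp0).subset fun x hx => ?_
  have hx : x ^ 2 + W = c * (x + T) ^ 2 := hx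
  simp only [hp, Set.mem_ofPred_eq, Polynomial.IsRoot.def, Polynomial.eval_add, Polynomial.eval_mul,
    Polynomial.eval_C, Polynomial.eval_pow, Polynomial.eval_X]
  linarith

lemma gammaMeasure_finite_null (α : ℝ) {s : Set ℝ} (hs : s.Finite) : gammaMeasure α 1 s = 0 :=
  withDensity_absolutelyContinuous _ _ (hs.measure_zero volume)

/-- The ratio has no atoms. -/
lemma ratioLaw_singleton {α : ℝ} (hα : 0 < α) {n : ℕ} (hn : 2 ≤ n) (c : ℝ) :
    ratioLaw α n {c} = 0 := by
  have := isProbabilityMeasure_gammaMeasure hα one_pos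
  obtain ⟨m, rfl⟩ : ∃ m, n = m + 1 := ⟨n - 1, by omega⟩
  have : Nonempty (Fin m) := ⟨⟨0, by omega⟩⟩
  rw [ratioLaw, Measure.map_apply (by fun_prop) (measurableSet_singleton c)]
  have hmp := (measurePreserving_piFinSuccAbove (fun _ : Fin (m + 1) => gammaMeasure α 1) 0).symm
  have hset : MeasurableSet (sumSqRatio ⁻¹' {c} : Set (Fin (m + 1) → ℝ)) :=
    measurable_sumSqRatio (measurableSet_singleton c)
  rw [← hmp.measure_preimage hset.nullMeasurableSet, ← Measure.prod_swap,
    Measure.map_apply measurable_swap (hmp.measurable hset),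
    Measure.measure_prod_null (measurable_swap (hmp.measurable hset))]
  filter_upwards [ae_pi_gammaMeasure_pos hα] with r hr
  have hT : 0 < ∑ i, r i := Finset.sum_pos (fun i _ => hr i) Finset.univ_nonempty
  -- With the other coordinates fixed, only finitely many values of the first give ratio c. The
  -- point where the sum vanishes is added by hand, since division by zero gives ratio 0 there.
  refine measure_mono_null (t := {x : ℝ | x ^ 2 + ∑ i, r i ^ 2 = c * (x + ∑ i, r i) ^ 2} ∪
    {-∑ i, r i}) (fun x hx => ?_)
    (gammaMeasure_finite_null α ((finite_setOf_quadratic_ratio_eq hT.ne').union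
      (Set.finite_singleton _)))
  have hx : sumSqRatio (Fin.cons x r : Fin (m + 1) → ℝ) = c := by
    simpa [Fin.consEquiv] using hx
  rw [sumSqRatio, Fin.sum_univ_succ, Fin.sum_univ_succ] at hx
  simp only [Fin.cons_zero, Fin.cons_succ] at hx
  by_cases h0 : x + ∑ i, r i = 0
  · right
    exact eq_neg_of_add_eq_zero_left h0
  · left
    rwa [div_eq_iff (pow_ne_zero 2 h0)] at hx

/-- Cauchy–Schwarz for the lower bound, positivity of the coordinates for the upper. This places the
angle θ in [0, π]. -/
lemma ratioLaw_ae_mem {α : ℝ} (hα : 0 < α) {n : ℕ} (hn : 0 < n) :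
    ∀ᵐ v ∂(ratioLaw α n), 1 / (n : ℝ) ≤ v ∧ v ≤ 1 := by
  have : Nonempty (Fin n) := ⟨⟨0, hn⟩⟩
  rw [ratioLaw, ae_map_iff (by fun_prop) (measurableSet_Icc (a := 1 / (n : ℝ)) (b := 1))]
  filter_upwards [ae_pi_gammaMeasure_pos hα] with x hx
  have hS : 0 < ∑ i, x i := Finset.sum_pos (fun i _ => hx i) Finset.univ_nonempty
  have hn' : (0 : ℝ) < n := by exact_mod_cast hn
  constructor
  · have := sq_sum_le_card_mul_sum_sq (s := (Finset.univ : Finset (Fin n))) (f := x)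
    rw [Finset.card_univ, Fintype.card_fin] at this
    rw [sumSqRatio, div_le_div_iff₀ hn' (by positivity)]
    linarith
  · rw [sumSqRatio, div_le_one (by positivity)]
    exact Finset.sum_sq_le_sq_sum_of_nonneg fun i _ => (hx i).le

/-! ### Sawtooth series -/

/-- Partial sums of the sawtooth series. -/
noncomputable def sawtoothSum (K : ℕ) (x : ℝ) : ℝ := ∑ k ∈ Finset.Icc 1 K, Real.sin (k * x) / k

lemma sawtoothSum_succ (K : ℕ) (x : ℝ) :
    sawtoothSum (K + 1) x = sawtoothSum K x + Real.sin ((K + 1 : ℕ) * x) / (K + 1 : ℕ) := by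
  rw [sawtoothSum, Finset.sum_Icc_succ_top (by omega), sawtoothSum]

lemma sawtoothSum_neg (K : ℕ) (x : ℝ) : sawtoothSum K (-x) = -sawtoothSum K x := by
  simp [sawtoothSum, Real.sin_neg, neg_div]

lemma sawtoothSum_two_pi_sub (K : ℕ) (x : ℝ) :
    sawtoothSum K (2 * Real.pi - x) = -sawtoothSum K x := by
  rw [sawtoothSum, sawtoothSum, ← Finset.sum_neg_distrib]
  refine Finset.sum_congr rfl fun k _ => ?_
  rw [mul_sub, Real.sin_nat_mul_two_pi_sub, neg_div]

lemma sawtoothSum_pi (K : ℕ) : sawtoothSum K Real.pi = 0 := by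
  simp [sawtoothSum, Real.sin_nat_mul_pi]

/-- The derivative ∑ cos kx is the Dirichlet kernel in closed form. -/
lemma hasDerivAt_sawtoothSum (K : ℕ) {x : ℝ} (hx : Real.sin (x / 2) ≠ 0) :
    HasDerivAt (sawtoothSum K)
      ((2 * Real.sin (x / 2))⁻¹ * Real.sin ((K + 1 / 2) * x) - 1 / 2) x := by
  induction K with
  | zero =>
    have h : HasDerivAt (fun _ : ℝ => (0 : ℝ)) 0 x := hasDerivAt_const x 0
    have e : sawtoothSum 0 = fun _ : ℝ => (0 : ℝ) := by ext; simp [sawtoothSum]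
    rw [e]
    refine h.congr_deriv ?_
    rw [show ((0 : ℕ) + 1 / 2 : ℝ) * x = x / 2 by push_cast; ring]
    field_simp
    ring
  | succ K ih =>
    have hk : ((K + 1 : ℕ) : ℝ) ≠ 0 := by positivity
    have h : HasDerivAt (fun x : ℝ => Real.sin ((K + 1 : ℕ) * x) / (K + 1 : ℕ))
        (Real.cos ((K + 1 : ℕ) * x)) x := by
      have h1 : HasDerivAt (fun x : ℝ => ((K + 1 : ℕ) : ℝ) * x) ((K + 1 : ℕ) : ℝ) x := by
        simpa using (hasDerivAt_id x).const_mul ((K + 1 : ℕ) : ℝ)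
      exact (h1.sin.div_const _).congr_deriv (mul_div_cancel_right₀ _ hk)
    have e : sawtoothSum (K + 1) =
        fun x => sawtoothSum K x + Real.sin ((K + 1 : ℕ) * x) / (K + 1 : ℕ) :=
      funext fun x => sawtoothSum_succ K x
    rw [e]
    refine (ih.add h).congr_deriv ?_
    have h2 : Real.sin (((K + 1 : ℕ) + 1 / 2) * x) - Real.sin ((K + 1 / 2) * x) =
        2 * Real.sin (x / 2) * Real.cos ((K + 1 : ℕ) * x) := by
      rw [Real.sin_sub_sin]
      push_cast
      ring_nf
    have h3 : Real.sin (((K + 1 : ℕ) + 1 / 2) * x) = Real.sin ((K + 1 / 2) * x) +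
        2 * Real.sin (x / 2) * Real.cos ((K + 1 : ℕ) * x) := by linarith
    rw [h3]
    field_simp
    ring

/-- Integrate the derivative from x to π, where the sum vanishes. The constant -1/2 yields (π -
x)/2; the oscillating part is integrated by parts against the decreasing function 1/(2 sin(u/2)), at
most π/(2x) by Jordan's inequality. -/
lemma abs_sawtoothSum_sub_le {K : ℕ} (hK : 0 < K) {x : ℝ} (hx : 0 < x) (hxpi : x ≤ Real.pi) :
    |sawtoothSum K x - (Real.pi - x) / 2| ≤ Real.pi / (K * x) := by
  have hK' : (0 : ℝ) < K := by exact_mod_cast hK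
  set N : ℝ := K + 1 / 2 with hN
  have hN0 : 0 < N := by positivity
  have hsin : ∀ u ∈ Set.Icc x Real.pi, 0 < Real.sin (u / 2) := fun u hu =>
    Real.sin_pos_of_pos_of_lt_pi (by linarith [hu.1]) (by linarith [hu.2, Real.pi_pos])
  set f : ℝ → ℝ := fun u => (2 * Real.sin (u / 2))⁻¹ with hf
  set f' : ℝ → ℝ := fun u => -Real.cos (u / 2) / (2 * Real.sin (u / 2)) ^ 2 with hf'
  have hfd : ∀ u ∈ Set.Icc x Real.pi, HasDerivAt f (f' u) u := fun u hu => by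
    have h1 : HasDerivAt (fun u : ℝ => 2 * Real.sin (u / 2)) (Real.cos (u / 2)) u := by
      have h2 : HasDerivAt (fun u : ℝ => u / 2) (1 / 2) u := (hasDerivAt_id u).div_const 2
      exact (h2.sin.const_mul 2).congr_deriv (by ring)
    exact h1.inv (by have := hsin u hu; positivity)
  have hf'c : ContinuousOn f' (Set.Icc x Real.pi) :=
    ContinuousOn.div (by fun_prop) (by fun_prop) fun u hu => by
      have := hsin u hu
      positivity
  have hfc : ContinuousOn f (Set.Icc x Real.pi) := fun u hu =>
    (hfd u hu).continuousAt.continuousWithinAt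
  have hgd : ∀ u ∈ Set.Icc x Real.pi,
      HasDerivAt (fun u : ℝ => ((-(Real.cos (N * u) / N) : ℝ) : ℂ)) ((Real.sin (N * u) : ℝ) : ℂ) u := by
    intro u _
    have h1 : HasDerivAt (fun u : ℝ => N * u) N u := by
      simpa using (hasDerivAt_id u).const_mul N
    exact ((h1.cos.div_const N).neg.congr_deriv (by field_simp)).ofReal_comp
  have key := norm_integral_mul_deriv_le (M := 1 / N) hxpi hfd hgd hf'c
    (Continuous.continuousOn (by fun_prop)) (fun u _ => by
      rw [norm_real, norm_neg, norm_div, Real.norm_of_nonneg hN0.le, Real.norm_eq_abs]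
      gcongr
      exact Real.abs_cos_le_one _)
  simp only [← Complex.ofReal_mul] at key
  rw [intervalIntegral.integral_ofReal, norm_real, Real.norm_eq_abs] at key
  have hI : ∫ u in x..Real.pi, (f u * Real.sin (N * u) - 1 / 2) =
      sawtoothSum K Real.pi - sawtoothSum K x := by
    refine intervalIntegral.integral_eq_sub_of_hasDerivAt (fun u hu => ?_) ?_
    · rw [Set.uIcc_of_le hxpi] at hu
      exact hasDerivAt_sawtoothSum K (hsin u hu).ne'
    · refine ContinuousOn.intervalIntegrable ?_
      rw [Set.uIcc_of_le hxpi]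
      exact (hfc.mul (by fun_prop)).sub continuousOn_const
  have hfs : IntervalIntegrable (fun u => f u * Real.sin (N * u)) volume x Real.pi := by
    refine ContinuousOn.intervalIntegrable ?_
    rw [Set.uIcc_of_le hxpi]
    exact hfc.mul (by fun_prop)
  rw [intervalIntegral.integral_sub hfs (by simp), intervalIntegral.integral_const,
    sawtoothSum_pi, smul_eq_mul] at hI
  have hV : ∫ u in x..Real.pi, |f' u| = f x - f Real.pi := by
    have h1 : ∫ u in x..Real.pi, |f' u| = ∫ u in x..Real.pi, -f' u := by
      refine intervalIntegral.integral_congr fun u hu => ?_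
      rw [Set.uIcc_of_le hxpi] at hu
      have : 0 ≤ Real.cos (u / 2) :=
        Real.cos_nonneg_of_neg_pi_div_two_le_of_le (by linarith [hu.1, Real.pi_pos])
          (by linarith [hu.2])
      refine abs_of_nonpos ?_
      exact div_nonpos_of_nonpos_of_nonneg (by linarith) (by positivity)
    rw [← Set.uIcc_of_le hxpi] at hfd hf'c
    rw [h1, intervalIntegral.integral_neg,
      intervalIntegral.integral_eq_sub_of_hasDerivAt hfd hf'c.intervalIntegrable]
    ring
  have hfx : f x ≤ Real.pi / (2 * x) := by
    have h1 := Real.mul_le_sin (x := x / 2) (by linarith) (by linarith)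
    have h2 : 2 / Real.pi * (x / 2) = x / Real.pi := by ring
    rw [h2] at h1
    have h3 : 0 < x / Real.pi := div_pos hx Real.pi_pos
    calc f x ≤ (2 * (x / Real.pi))⁻¹ := by
          simp only [hf]
          gcongr
      _ = _ := by field_simp
  have hfx0 : 0 ≤ f x := by
    have := hsin x (Set.left_mem_Icc.2 hxpi)
    simp only [hf]
    positivity
  have hfpi0 : 0 ≤ f Real.pi := by
    have := hsin Real.pi (Set.right_mem_Icc.2 hxpi)
    simp only [hf]
    positivity
  rw [hV, abs_of_nonneg hfx0, abs_of_nonneg hfpi0] at key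
  have e : sawtoothSum K x - (Real.pi - x) / 2 =
      -∫ u in x..Real.pi, f u * Real.sin (N * u) := by linarith
  rw [e, abs_neg]
  refine key.trans ?_
  calc 1 / N * (f x + f Real.pi + (f x - f Real.pi)) = 1 / N * (2 * f x) := by ring
    _ ≤ 1 / K * (2 * (Real.pi / (2 * x))) := by
        gcongr
        linarith
    _ = _ := by field_simp

lemma tendsto_sawtoothSum {x : ℝ} (hx : 0 < x) (hx2 : x < 2 * Real.pi) :
    Tendsto (fun K => sawtoothSum K x) atTop (𝓝 ((Real.pi - x) / 2)) := by
  have main : ∀ x : ℝ, 0 < x → x ≤ Real.pi →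
      Tendsto (fun K => sawtoothSum K x) atTop (𝓝 ((Real.pi - x) / 2)) := by
    intro x hx hxpi
    rw [tendsto_iff_norm_sub_tendsto_zero]
    have h0 : Tendsto (fun K : ℕ => Real.pi / x * (1 / (K : ℝ))) atTop (𝓝 0) := by
      simpa using tendsto_one_div_atTop_nhds_zero_nat.const_mul (Real.pi / x)
    refine squeeze_zero' (Eventually.of_forall fun K => norm_nonneg _) ?_ h0
    filter_upwards [eventually_gt_atTop 0] with K hK
    rw [Real.norm_eq_abs]
    refine (abs_sawtoothSum_sub_le hK hx hxpi).trans (le_of_eq ?_)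
    have : (K : ℝ) ≠ 0 := by positivity
    field_simp
  rcases le_total x Real.pi with h | h
  · exact main x hx h
  · have h1 := (main (2 * Real.pi - x) (by linarith) (by linarith)).neg
    simp only [sawtoothSum_two_pi_sub, neg_neg] at h1
    convert h1 using 2
    ring

/-- On [0, π]: if Kx ≤ 1 each term is at most x; otherwise the sum lies within π of (π - x)/2, and
3π/2 < 5. Reflection in π and oddness do the rest. -/
lemma abs_sawtoothSum_le (K : ℕ) {x : ℝ} (hx : |x| ≤ 2 * Real.pi) : |sawtoothSum K x| ≤ 5 := by
  have main : ∀ x : ℝ, 0 ≤ x → x ≤ Real.pi → |sawtoothSum K x| ≤ 5 := by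
    intro x hx hxpi
    rcases le_or_gt (K * x) 1 with h | h
    · have h1 : |sawtoothSum K x| ≤ ∑ k ∈ Finset.Icc 1 K, x := by
        refine (Finset.abs_sum_le_sum_abs _ _).trans (Finset.sum_le_sum fun k hk => ?_)
        have hk0 : (0 : ℝ) < k := by
          have := (Finset.mem_Icc.1 hk).1
          exact_mod_cast this
        rw [abs_div, abs_of_pos hk0, div_le_iff₀ hk0]
        refine Real.abs_sin_le_abs.trans ?_
        rw [abs_of_nonneg (by positivity), mul_comm]
      rw [Finset.sum_const, Nat.card_Icc, nsmul_eq_mul] at h1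
      simp only [add_tsub_cancel_right] at h1
      linarith
    · have hK : 0 < K := by
        rcases Nat.eq_zero_or_pos K with rfl | h'
        · norm_num at h
        · exact h'
      have hx0 : 0 < x := by
        rcases hx.eq_or_lt with rfl | h'
        · norm_num at h
        · exact h'
      have h1 := abs_le.1 (abs_sawtoothSum_sub_le hK hx0 hxpi)
      have h2 : Real.pi / (K * x) ≤ Real.pi := div_le_self Real.pi_pos.le h.le
      have h3 := Real.pi_lt_d2
      rw [abs_le]
      constructor <;> linarith
  have main2 : ∀ x : ℝ, 0 ≤ x → x ≤ 2 * Real.pi → |sawtoothSum K x| ≤ 5 := by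
    intro x hx hx2
    rcases le_total x Real.pi with h | h
    · exact main x hx h
    · have := main (2 * Real.pi - x) (by linarith) (by linarith)
      rwa [sawtoothSum_two_pi_sub, abs_neg] at this
  rcases le_total 0 x with h | h
  · exact main2 x h ((le_abs_self x).trans hx)
  · have := main2 (-x) (by linarith) ((neg_le_abs x).trans hx)
    rwa [sawtoothSum_neg, abs_neg] at this

/-- Partial sums of the sine series of the indicator of `θ < y`. -/
lemma sum_sin_mul_one_sub_cos_eq (K : ℕ) (θ y : ℝ) :
    ∑ k ∈ Finset.Icc 1 K, Real.sin (k * θ) * (1 - Real.cos (k * y)) / k =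
      sawtoothSum K θ - sawtoothSum K (θ + y) / 2 - sawtoothSum K (θ - y) / 2 := by
  simp only [sawtoothSum]
  rw [Finset.sum_div, Finset.sum_div, ← Finset.sum_sub_distrib, ← Finset.sum_sub_distrib]
  refine Finset.sum_congr rfl fun k _ => ?_
  rw [mul_add, mul_sub (k : ℝ) θ y, Real.sin_add, Real.sin_sub]
  ring

lemma abs_sum_sin_mul_one_sub_cos_le (K : ℕ) {θ y : ℝ} (hθ : 0 ≤ θ) (hθpi : θ ≤ Real.pi)
    (hy : 0 ≤ y) (hypi : y ≤ Real.pi) :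
    |∑ k ∈ Finset.Icc 1 K, Real.sin (k * θ) * (1 - Real.cos (k * y)) / k| ≤ 10 := by
  rw [sum_sin_mul_one_sub_cos_eq]
  have h1 := abs_le.1 (abs_sawtoothSum_le K (x := θ) (by rw [abs_le]; constructor <;> linarith))
  have h2 := abs_le.1 (abs_sawtoothSum_le K (x := θ + y) (by rw [abs_le]; constructor <;> linarith))
  have h3 := abs_le.1 (abs_sawtoothSum_le K (x := θ - y) (by rw [abs_le]; constructor <;> linarith))
  rw [abs_le]
  constructor <;> linarith

/-- The jump of the sawtooth at 0 separates θ < y from θ > y. At θ = y the third sawtooth sits on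
its jump, so that point is excluded and later discarded as a null set. -/
lemma tendsto_sum_sin_mul_one_sub_cos {θ y : ℝ} (hθ : 0 < θ) (hθpi : θ < Real.pi)
    (hy : 0 ≤ y) (hypi : y ≤ Real.pi) (hne : θ ≠ y) :
    Tendsto (fun K : ℕ => ∑ k ∈ Finset.Icc 1 K, Real.sin (k * θ) * (1 - Real.cos (k * y)) / k) atTop
      (𝓝 (if θ < y then Real.pi / 2 else 0)) := by
  simp_rw [sum_sin_mul_one_sub_cos_eq]
  have h1 := tendsto_sawtoothSum hθ (by linarith)
  have h2 := tendsto_sawtoothSum (x := θ + y) (by linarith) (by linarith)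
  split_ifs with h
  · have h3 := (tendsto_sawtoothSum (x := y - θ) (by linarith) (by linarith)).neg
    simp only [← sawtoothSum_neg, neg_sub] at h3
    convert (h1.sub (h2.div_const 2)).sub (h3.div_const 2) using 2
    ring
  · have h4 : y < θ := lt_of_le_of_ne (not_lt.1 h) hne.symm
    have h3 := tendsto_sawtoothSum (x := θ - y) (by linarith) (by linarith)
    convert (h1.sub (h2.div_const 2)).sub (h3.div_const 2) using 2
    ring

/-! ### Integrals of the terms and the limit -/

lemma integral_cexp_I_im {ν : Measure ℝ} [IsProbabilityMeasure ν] (f : ℝ → ℝ) (hf : Measurable f) :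
    (∫ v, exp (I * (f v : ℂ)) ∂ν).im = ∫ v, Real.sin (f v) ∂ν := by
  have hint : Integrable (fun v => exp (I * (f v : ℂ))) ν :=
    Integrable.mono' (integrable_const (1 : ℝ)) (by fun_prop)
      (ae_of_all _ fun v => (norm_cexp_I_mul_ofReal _).le)
  have h := integral_im hint
  simp only [RCLike.im_eq_complex_im] at h
  rw [← h]
  refine integral_congr_ae (ae_of_all _ fun v => ?_)
  beta_reduce
  rw [mul_comm, Complex.exp_ofReal_mul_I_im]

lemma fourierNode_pos {α : ℝ} (hα : 0 < α) {n k : ℕ} (hn : 2 ≤ n) (hk : 1 ≤ k) :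
    0 < fourierNode α n k := by
  have hn' : (2 : ℝ) ≤ n := by exact_mod_cast hn
  have hk' : (1 : ℝ) ≤ k := by exact_mod_cast hk
  have h1 : (0 : ℝ) < (n : ℝ) - 1 := by linarith
  have := Real.pi_pos
  unfold fourierNode
  positivity

lemma norm_cexp_phase (α s : ℝ) (n k : ℕ) :
    ‖exp (-I * α * n * s - I * (k * Real.pi / ((n : ℂ) - 1)))‖ = 1 := by
  rw [show -I * (α : ℂ) * n * s - I * (k * Real.pi / ((n : ℂ) - 1)) =
    I * ((-(α * n * s) - k * Real.pi / ((n : ℝ) - 1) : ℝ) : ℂ) by push_cast; ring,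
    norm_cexp_I_mul_ofReal]

lemma abs_cdfTerm_le (α : ℝ) (n : ℕ) (x : ℝ) (k : ℕ) (s : ℝ) :
    |cdfTerm α n x k s| ≤ ‖gammaPsi α s (fourierNode α n k)‖ ^ n * (2 / k) := by
  rw [cdfTerm, mul_div_assoc, abs_mul]
  gcongr
  · refine (Complex.abs_im_le_norm _).trans ?_
    rw [norm_mul, norm_cexp_phase, mul_one, norm_pow]
  · rw [abs_div, Nat.abs_cast]
    gcongr
    have h1 := Real.neg_one_le_cos (k * Real.pi * x / (1 - 1 / (n : ℝ)))
    have h2 := Real.cos_le_one (k * Real.pi * x / (1 - 1 / (n : ℝ)))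
    rw [abs_of_nonneg (by linarith)]
    linarith

lemma continuous_cdfTerm {α : ℝ} (hα : 0 < α) {n k : ℕ} (hn : 2 ≤ n) (hk : 1 ≤ k) (x : ℝ) :
    Continuous (cdfTerm α n x k) := by
  have := continuous_gammaPsi hα (fourierNode_pos hα hn hk)
  unfold cdfTerm
  fun_prop

lemma integrable_cdfTerm {α : ℝ} (hα : 0 < α) {n k : ℕ} (hn : 2 ≤ n) (hk : 1 ≤ k) (x : ℝ)
    (hint : ∀ t : ℝ, 0 < t → Integrable (fun s : ℝ => gammaPsi α s t ^ n)) :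
    Integrable (cdfTerm α n x k) := by
  refine Integrable.mono' ((hint _ (fourierNode_pos hα hn hk)).norm.mul_const (2 / (k : ℝ)))
    (continuous_cdfTerm hα hn hk x).aestronglyMeasurable (ae_of_all _ fun s => ?_)
  rw [norm_pow]
  exact abs_cdfTerm_le α n x k s

/-- The integral of a single term of the cdf series, as an integral against the law of the
ratio; the constant is the density at `α n` of the gamma law with shape `α n`. -/
lemma integral_cdfTerm {α : ℝ} (hα : 0 < α) {n k : ℕ} (hn : 2 ≤ n) (hk : 1 ≤ k) (x : ℝ)
    (hint : ∀ t : ℝ, 0 < t → Integrable (fun s : ℝ => gammaPsi α s t ^ n)) :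
    ∫ s, cdfTerm α n x k s =
      2 * Real.pi * ((α * n) ^ (α * n - 1) * Real.exp (-(α * n)) / Real.Gamma (α * n)) *
        ∫ v, Real.sin (k * (Real.pi * (v - 1 / n) / (1 - 1 / n))) *
          (1 - Real.cos (k * (Real.pi * x / (1 - 1 / n)))) / k ∂(ratioLaw α n) := by
  have := isProbabilityMeasure_ratioLaw hα n
  have hn' : (2 : ℝ) ≤ n := by exact_mod_cast hn
  have hn0 : (n : ℝ) ≠ 0 := by linarith
  have hn1 : (n : ℝ) - 1 ≠ 0 := by linarith
  have ht := fourierNode_pos hα hn hk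
  set t := fourierNode α n k with ht'
  have hm : 0 < α * n := by positivity
  have key := integral_gammaPsi_pow_mul_cexp hα (by omega : 0 < n) ht hm (hint t ht)
  set D := 2 * Real.pi * ((α * n) ^ (α * n - 1) * Real.exp (-(α * n)) / Real.Gamma (α * n)) with hD
  -- The reason for the choice of t_k: it gives t_k(αn)² = kπ/(1 - 1/n), and kπ/(n-1) is the value
  -- of that multiple at v = 1/n.
  have hnode : ∀ v : ℝ, t * (α * n) ^ 2 * v - k * Real.pi / ((n : ℝ) - 1) =
      k * (Real.pi * (v - 1 / n) / (1 - 1 / n)) := by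
    intro v
    rw [ht', fourierNode]
    field_simp
  have hF : ∀ s : ℝ, gammaPsi α s t ^ n * exp (-I * α * n * s - I * (k * Real.pi / ((n : ℂ) - 1))) =
      exp (-(I * (k * Real.pi / ((n : ℂ) - 1)))) *
        (gammaPsi α s t ^ n * exp (-(I * ((α * n * s : ℝ) : ℂ)))) := by
    intro s
    rw [show -I * (α : ℂ) * n * s - I * (k * Real.pi / ((n : ℂ) - 1)) =
      -(I * (k * Real.pi / ((n : ℂ) - 1))) + -(I * ((α * n * s : ℝ) : ℂ)) by push_cast; ring,
      Complex.exp_add]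
    ring
  have hFint : Integrable fun s : ℝ =>
      gammaPsi α s t ^ n * exp (-I * α * n * s - I * (k * Real.pi / ((n : ℂ) - 1))) := by
    refine Integrable.mono (hint t ht) ?_ (ae_of_all _ fun s => ?_)
    · have := continuous_gammaPsi hα ht
      exact Continuous.aestronglyMeasurable (by fun_prop)
    · rw [norm_mul, norm_cexp_phase, mul_one]
  have h1 : ∫ s : ℝ, (gammaPsi α s t ^ n *
      exp (-I * α * n * s - I * (k * Real.pi / ((n : ℂ) - 1)))).im =
      D * ∫ v, Real.sin (k * (Real.pi * (v - 1 / n) / (1 - 1 / n))) ∂(ratioLaw α n) := by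
    have h2 := integral_im hFint
    simp only [RCLike.im_eq_complex_im] at h2
    rw [h2]
    simp_rw [hF]
    rw [integral_const_mul, key, mul_left_comm, ← integral_const_mul]
    have h3 : ∀ v : ℝ, exp (-(I * (k * Real.pi / ((n : ℂ) - 1)))) *
        exp (I * ((t * (α * n) ^ 2 * v : ℝ) : ℂ)) =
        exp (I * ((k * (Real.pi * (v - 1 / n) / (1 - 1 / n)) : ℝ) : ℂ)) := by
      intro v
      rw [← Complex.exp_add, ← hnode]
      congr 1
      push_cast
      ring
    simp_rw [h3]
    rw [Complex.im_ofReal_mul, integral_cexp_I_im _ (by fun_prop)]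
  have h4 : ∀ s, cdfTerm α n x k s = (gammaPsi α s t ^ n *
      exp (-I * α * n * s - I * (k * Real.pi / ((n : ℂ) - 1)))).im *
      ((1 - Real.cos (k * (Real.pi * x / (1 - 1 / n)))) / k) := by
    intro s
    rw [cdfTerm, mul_div_assoc]
    congr 4
    ring
  simp_rw [h4, mul_div_assoc (Real.sin _)]
  rw [integral_mul_const, integral_mul_const, h1, mul_assoc]

/-- The constant is the reciprocal of 2π · (gamma density of shape αn at αn) · π/2, by Γ(m+1) =
mΓ(m). -/
lemma cdfConst_mul_density {α : ℝ} (hα : 0 < α) {n : ℕ} (hn : 0 < n) :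
    cdfConst α n * (2 * Real.pi *
      ((α * n) ^ (α * n - 1) * Real.exp (-(α * n)) / Real.Gamma (α * n)) * (Real.pi / 2)) = 1 := by
  have hn' : (0 : ℝ) < n := by exact_mod_cast hn
  have hm : 0 < α * n := by positivity
  have hG := Real.Gamma_pos_of_pos hm
  have hp : 0 < (α * n) ^ (α * n) := Real.rpow_pos_of_pos hm _
  rw [cdfConst, Real.Gamma_add_one hm.ne', Real.div_rpow hm.le (Real.exp_pos 1).le,
    ← Real.exp_mul, one_mul, Real.exp_neg, Real.rpow_sub_one hm.ne']
  have := Real.pi_pos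
  field_simp

/-- The integrals of the partial sums converge to a multiple of the distribution function. -/
lemma tendsto_integral_sum_cdfTerm {α : ℝ} (hα : 0 < α) {n : ℕ} (hn : 2 ≤ n) {x : ℝ} (hx : 0 ≤ x)
    (hx1 : x ≤ 1 - 1 / (n : ℝ))
    (hint : ∀ t : ℝ, 0 < t → Integrable (fun s : ℝ => gammaPsi α s t ^ n)) :
    Tendsto (fun K : ℕ => ∫ s : ℝ, ∑ k ∈ Finset.Icc 1 K, cdfTerm α n x k s) atTop
      (𝓝 (2 * Real.pi * ((α * n) ^ (α * n - 1) * Real.exp (-(α * n)) / Real.Gamma (α * n)) *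
        (Real.pi / 2) * (ratioLaw α n).real {v | v - 1 / (n : ℝ) ≤ x})) := by
  have := isProbabilityMeasure_ratioLaw hα n
  have hn' : (2 : ℝ) ≤ n := by exact_mod_cast hn
  have hpi := Real.pi_pos
  have hc : 0 < 1 - 1 / (n : ℝ) := by
    rw [sub_pos, div_lt_one (by linarith)]
    linarith
  set c := 1 - 1 / (n : ℝ) with hcdef
  set D := 2 * Real.pi * ((α * n) ^ (α * n - 1) * Real.exp (-(α * n)) / Real.Gamma (α * n)) with hD
  set θ : ℝ → ℝ := fun v => Real.pi * (v - 1 / n) / c with hθ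
  set y := Real.pi * x / c with hy
  have hy0 : 0 ≤ y := by positivity
  have hypi : y ≤ Real.pi := by
    rw [hy, div_le_iff₀ hc]
    gcongr
  have hterm : ∀ k : ℕ, 1 ≤ k → Integrable (fun v => Real.sin (k * θ v) * (1 - Real.cos (k * y)) / k)
      (ratioLaw α n) := by
    intro k _
    have h1 : Integrable (fun v => Real.sin (k * θ v)) (ratioLaw α n) :=
      Integrable.mono' (integrable_const (1 : ℝ))
        (Measurable.aestronglyMeasurable (by fun_prop))
        (ae_of_all _ fun v => Real.abs_sin_le_one _)
    exact (h1.mul_const _).div_const _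
  have hsum : ∀ K : ℕ, ∫ s : ℝ, ∑ k ∈ Finset.Icc 1 K, cdfTerm α n x k s =
      D * ∫ v, ∑ k ∈ Finset.Icc 1 K, Real.sin (k * θ v) * (1 - Real.cos (k * y)) / k
        ∂(ratioLaw α n) := by
    intro K
    rw [integral_finsetSum _ fun k hk => integrable_cdfTerm hα hn (Finset.mem_Icc.1 hk).1 x hint,
      integral_finsetSum _ fun k hk => hterm k (Finset.mem_Icc.1 hk).1, Finset.mul_sum]
    exact Finset.sum_congr rfl fun k hk => integral_cdfTerm hα hn (Finset.mem_Icc.1 hk).1 x hint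
  simp_rw [hsum]
  rw [mul_assoc]
  refine Tendsto.const_mul D ?_
  have hset : MeasurableSet {v : ℝ | v - 1 / (n : ℝ) ≤ x} :=
    measurableSet_le (by fun_prop) measurable_const
  have hlim : ∫ v, {v : ℝ | v - 1 / (n : ℝ) ≤ x}.indicator (fun _ => Real.pi / 2) v
      ∂(ratioLaw α n) = Real.pi / 2 * (ratioLaw α n).real {v | v - 1 / (n : ℝ) ≤ x} := by
    rw [integral_indicator_const _ hset, smul_eq_mul, mul_comm]
  rw [← hlim]
  have hmem := ratioLaw_ae_mem hα (by omega : 0 < n)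
  -- Without atoms, the endpoints θ = 0, π and the jump θ = y can be discarded.
  have hne : ∀ d : ℝ, ∀ᵐ v ∂(ratioLaw α n), v ≠ d := fun d => by
    rw [ae_iff]
    simpa using ratioLaw_singleton hα hn d
  refine tendsto_integral_of_dominated_convergence (fun _ => 10)
    (fun K => Measurable.aestronglyMeasurable (by fun_prop)) (integrable_const _) (fun K => ?_) ?_
  · filter_upwards [hmem] with v hv
    have h0 : 0 ≤ θ v := div_nonneg (mul_nonneg hpi.le (by linarith [hv.1])) hc.le
    have h1 : θ v ≤ Real.pi := by
      simp only [hθ]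
      rw [div_le_iff₀ hc]
      gcongr
      linarith [hv.2]
    exact abs_sum_sin_mul_one_sub_cos_le K h0 h1 hy0 hypi
  · filter_upwards [hmem, hne (1 / n), hne 1, hne (x + 1 / n)] with v hv h0 h1 h2
    have h0' : 0 < v - 1 / (n : ℝ) := by
      rcases hv.1.lt_or_eq with h | h
      · linarith
      · exact absurd h.symm h0
    have h1' : v < 1 := lt_of_le_of_ne hv.2 h1
    have h2' : v - 1 / (n : ℝ) ≠ x := fun h => h2 (by linarith)
    have hθ0 : 0 < θ v := by simp only [hθ]; positivity
    have hθpi : θ v < Real.pi := by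
      simp only [hθ]
      rw [div_lt_iff₀ hc]
      gcongr
      linarith
    have hlt : θ v < y ↔ v - 1 / (n : ℝ) < x := by
      simp only [hθ, hy]
      rw [div_lt_div_iff_of_pos_right hc, mul_lt_mul_iff_right₀ hpi]
    have hney : θ v ≠ y := by
      simp only [hθ, hy]
      rw [Ne, div_left_inj' hc.ne', mul_right_inj' hpi.ne']
      exact h2'
    have := tendsto_sum_sin_mul_one_sub_cos hθ0 hθpi hy0 hypi hney
    convert this using 2
    rw [Set.indicator_apply]
    refine if_congr ?_ rfl rfl
    rw [hlt, Set.mem_ofPred_eq]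
    exact ⟨fun h => lt_of_le_of_ne h h2', le_of_lt⟩

/-- The distribution function of the ratio in terms of its law. -/
lemma measureReal_squareSumRatio_eq {Ω : Type*} [MeasurableSpace Ω] {P : Measure Ω}
    [IsProbabilityMeasure P] {α : ℝ} {n : ℕ} {X : Fin n → Ω → ℝ}
    (hlaw : ∀ i, HasLaw (X i) (gammaMeasure α 1) P) (hindep : iIndepFun X P) (x : ℝ) :
    P.real {ω | squareSumRatio X ω - 1 / (n : ℝ) ≤ x} =
      (ratioLaw α n).real {v | v - 1 / (n : ℝ) ≤ x} := by
  have hX : ∀ i, AEMeasurable (X i) P := fun i => (hlaw i).aemeasurable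
  have hmap := (iIndepFun_iff_map_fun_eq_pi_map hX).1 hindep
  simp_rw [fun i => (hlaw i).map_eq] at hmap
  have hset : MeasurableSet {v : ℝ | v - 1 / (n : ℝ) ≤ x} :=
    measurableSet_le (by fun_prop) measurable_const
  rw [measureReal_def, measureReal_def, ratioLaw, ← hmap,
    Measure.map_apply (by fun_prop) hset,
    Measure.map_apply_of_aemeasurable (aemeasurable_pi_lambda _ hX) (measurable_sumSqRatio hset)]
  rfl

/-! ### Exchange of sum and integral -/

lemma sum_Icc_one_eq_sum_range (f : ℕ → ℝ) (K : ℕ) :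
    ∑ k ∈ Finset.Icc 1 K, f k = ∑ k ∈ Finset.range K, f (k + 1) := by
  induction K with
  | zero => simp
  | succ K ih => rw [Finset.sum_Icc_succ_top (by omega), ih, Finset.sum_range_succ]

lemma exists_abs_cdfTerm_le {α β : ℝ} (hα : 0 < α) (hβ0 : 0 < β) (hβ : β < 1) (hβα : β ≤ α)
    {n : ℕ} (hn : 2 ≤ n) (hnβ : 3 < n * β) (x : ℝ) :
    ∃ C : ℝ, 0 < C ∧ ∀ (k : ℕ) (s : ℝ), |cdfTerm α n x (k + 1) s| ≤
      C * ((k : ℝ) + 1) ^ (-(10 / 9) : ℝ) * (1 + |s|) ^ (-(10 / 9) : ℝ) := by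
  have h1 := fourierNode_pos hα hn le_rfl
  obtain ⟨C, hC, h⟩ := exists_norm_gammaPsi_pow_le hα hβ0 hβ hβα h1 hnβ
  refine ⟨2 * C * fourierNode α n 1 ^ (-(1 / 9) : ℝ), by positivity, fun k s => ?_⟩
  have hk : (0 : ℝ) < (k : ℝ) + 1 := by positivity
  have hnode : fourierNode α n (k + 1) = ((k : ℝ) + 1) * fourierNode α n 1 := by
    simp only [fourierNode]
    push_cast
    ring
  have hle : fourierNode α n 1 ≤ fourierNode α n (k + 1) := by
    rw [hnode]
    have : (0 : ℝ) ≤ k := by positivity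
    nlinarith
  refine (abs_cdfTerm_le α n x (k + 1) s).trans ?_
  have h2 := h s _ hle
  rw [hnode, Real.mul_rpow hk.le h1.le, ← hnode] at h2
  -- The node contributes (k+1)^(-1/9), and the divisor k+1 raises this to the summable exponent
  -- 10/9.
  have h3 : ((k : ℝ) + 1) ^ (-(10 / 9) : ℝ) = ((k : ℝ) + 1) ^ (-(1 / 9) : ℝ) / ((k : ℝ) + 1) := by
    rw [← Real.rpow_sub_one hk.ne']
    norm_num
  calc _ ≤ C * (((k : ℝ) + 1) ^ (-(1 / 9) : ℝ) * fourierNode α n 1 ^ (-(1 / 9) : ℝ) *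
        (1 + |s|) ^ (-(10 / 9) : ℝ)) * (2 / ((k : ℝ) + 1)) := by
        push_cast
        gcongr
    _ = _ := by rw [h3]; ring

lemma summable_nat_add_one_rpow :
    Summable (fun k : ℕ => ((k : ℝ) + 1) ^ (-(10 / 9) : ℝ)) := by
  have h := (summable_nat_add_iff (f := fun k : ℕ => (k : ℝ) ^ (-(10 / 9) : ℝ)) 1).2
    (Real.summable_nat_rpow.2 (by norm_num))
  simpa using h

/-- The limit may be taken under the integral when the terms are jointly dominated. -/
lemma tendsto_integral_sum_cdfTerm_tsum {α β : ℝ} (hα : 0 < α) (hβ0 : 0 < β) (hβ : β < 1)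
    (hβα : β ≤ α) {n : ℕ} (hn : 2 ≤ n) (hnβ : 3 < n * β) (x : ℝ) :
    (∀ s : ℝ, Summable (fun k : ℕ => cdfTerm α n x (k + 1) s)) ∧
      Integrable (fun s : ℝ => ∑' k : ℕ, cdfTerm α n x (k + 1) s) ∧
      Tendsto (fun K : ℕ => ∫ s : ℝ, ∑ k ∈ Finset.Icc 1 K, cdfTerm α n x k s) atTop
        (𝓝 (∫ s : ℝ, ∑' k : ℕ, cdfTerm α n x (k + 1) s)) := by
  obtain ⟨C, hC, h⟩ := exists_abs_cdfTerm_le hα hβ0 hβ hβα hn hnβ x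
  have hdom : Integrable (fun s : ℝ => (1 + |s|) ^ (-(10 / 9) : ℝ)) :=
    integrable_one_add_norm (E := ℝ) (by norm_num)
  have hle1 : ∀ s : ℝ, (1 + |s|) ^ (-(10 / 9) : ℝ) ≤ 1 := fun s =>
    Real.rpow_le_one_of_one_le_of_nonpos (by linarith [abs_nonneg s]) (by norm_num)
  have hb : Summable (fun k : ℕ => C * ((k : ℝ) + 1) ^ (-(10 / 9) : ℝ)) :=
    summable_nat_add_one_rpow.mul_left C
  have hbs : ∀ s : ℝ, Summable (fun k : ℕ =>
      C * ((k : ℝ) + 1) ^ (-(10 / 9) : ℝ) * (1 + |s|) ^ (-(10 / 9) : ℝ)) := fun s =>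
    hb.mul_right _
  have hsum : ∀ s : ℝ, Summable (fun k : ℕ => cdfTerm α n x (k + 1) s) := fun s =>
    Summable.of_norm_bounded (hbs s) fun k => h k s
  have hcont : ∀ k : ℕ, Continuous (cdfTerm α n x (k + 1)) := fun k =>
    continuous_cdfTerm hα hn (by omega) x
  have hint : ∀ k : ℕ, Integrable (cdfTerm α n x (k + 1)) := fun k =>
    Integrable.mono' (hdom.const_mul _) (hcont k).aestronglyMeasurable
      (ae_of_all _ fun s => h k s)
  refine ⟨hsum, ?_, ?_⟩
  · have hc : Continuous (fun s : ℝ => ∑' k : ℕ, cdfTerm α n x (k + 1) s) := by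
      refine continuous_tsum hcont hb fun k s => (h k s).trans ?_
      exact mul_le_of_le_one_right (by positivity) (hle1 s)
    refine Integrable.mono' (hdom.const_mul (∑' k : ℕ, C * ((k : ℝ) + 1) ^ (-(10 / 9) : ℝ)))
      hc.aestronglyMeasurable (ae_of_all _ fun s => ?_)
    rw [← tsum_mul_right]
    exact tsum_of_norm_bounded (hbs s).hasSum fun k => h k s
  · have hnorm : Summable fun k : ℕ => ∫ s, ‖cdfTerm α n x (k + 1) s‖ := by
      refine Summable.of_nonneg_of_le (fun k => integral_nonneg fun s => norm_nonneg _)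
        (fun k => ?_) (hb.mul_right (∫ s : ℝ, (1 + |s|) ^ (-(10 / 9) : ℝ)))
      rw [← integral_const_mul]
      exact integral_mono (hint k).norm (hdom.const_mul _) fun s => h k s
    have h2 := (hasSum_integral_of_summable_integral_norm hint hnorm).tendsto_sum_nat
    refine h2.congr fun K => ?_
    simp_rw [fun s => sum_Icc_one_eq_sum_range (fun k => cdfTerm α n x k s) K]
    rw [integral_finsetSum _ fun k _ => hint k]

/-! ### Greenwood's statistic and the theorem -/

/-- For α = 1 the phase kπ/(n-1) equals n t_k, so the whole exponential is an n-th power and moves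
inside the bracket. -/
lemma greenwoodTerm_eq_cdfTerm {n : ℕ} (hn : 2 ≤ n) (x : ℝ) (k : ℕ) (s : ℝ) :
    greenwoodTerm n x k s = cdfTerm 1 n x k s := by
  have hn' : (2 : ℝ) ≤ n := by exact_mod_cast hn
  have hn0 : (n : ℝ) ≠ 0 := by linarith
  have hn1 : (n : ℝ) - 1 ≠ 0 := by linarith
  have hnode : fourierNode 1 n k = k * Real.pi / (n * ((n : ℝ) - 1)) := by
    rw [fourierNode, one_pow, one_mul]
  have hnt : (n : ℂ) * ((k * Real.pi / (n * ((n : ℝ) - 1)) : ℝ) : ℂ) =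
      k * Real.pi / ((n : ℂ) - 1) := by
    have : (n : ℝ) * (k * Real.pi / (n * ((n : ℝ) - 1))) = k * Real.pi / ((n : ℝ) - 1) := by
      field_simp
    exact_mod_cast congrArg (fun r : ℝ => (r : ℂ)) this
  rw [greenwoodTerm, cdfTerm, gammaPsi, hnode]
  generalize hT : (k * Real.pi / (n * ((n : ℝ) - 1)) : ℝ) = t at hnt
  congr 4
  simp only [← hnt, mul_pow, ← Complex.exp_nat_mul]
  have h1 : cexp ((n : ℂ) * (I * ((1 - I * (s : ℂ)) ^ 2 / (8 * (t : ℂ)) - t - s))) =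
      cexp (n * (I * (1 - I * (s : ℂ)) ^ 2 / (8 * (t : ℂ)))) *
        cexp (-I * ((1 : ℝ) : ℂ) * n * s - I * (n * t)) := by
    rw [← Complex.exp_add]
    congr 1
    push_cast
    ring
  rw [h1]
  push_cast
  ring

theorem theorem3 {Ω : Type*} [MeasurableSpace Ω] (P : Measure Ω) [IsProbabilityMeasure P]
    (α : ℝ) (hα : 0 < α) (n : ℕ) (hn : max 3 (1 + 1 / α) < (n : ℝ))
    (X : Fin n → Ω → ℝ) (hlaw : ∀ i, HasLaw (X i) (gammaMeasure α 1) P)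
    (hindep : iIndepFun X P) :
    -- `ψ` is the joint characteristic function of `(X, X²)`
    (∀ i, ∀ s t : ℝ, 0 < t →
      ∫ ω, exp (I * s * X i ω + I * t * (X i ω : ℂ) ^ 2) ∂P = gammaPsi α s t) ∧
    -- the cdf as a limit of integrals of finite sums
    (∀ x : ℝ, 0 ≤ x → x ≤ 1 - 1 / (n : ℝ) →
      (∀ K : ℕ, Integrable (fun s : ℝ => ∑ k ∈ Finset.Icc 1 K, cdfTerm α n x k s)) ∧
      ∃ l : ℝ,
        Tendsto (fun K : ℕ => ∫ s : ℝ, ∑ k ∈ Finset.Icc 1 K, cdfTerm α n x k s) atTop (𝓝 l) ∧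
        P.real {ω | squareSumRatio X ω - 1 / (n : ℝ) ≤ x} = cdfConst α n * l) ∧
    -- the limit may be taken under the integral
    (max 2 (max (1 + 1 / (2 * α)) (3 / (2 * α))) < ((n / 2 : ℕ) : ℝ) →
      ∀ x : ℝ, 0 ≤ x → x ≤ 1 - 1 / (n : ℝ) →
        (∀ s : ℝ, Summable (fun k : ℕ => cdfTerm α n x (k + 1) s)) ∧
        Integrable (fun s : ℝ => ∑' k : ℕ, cdfTerm α n x (k + 1) s) ∧
        Tendsto (fun K : ℕ => ∫ s : ℝ, ∑ k ∈ Finset.Icc 1 K, cdfTerm α n x k s) atTop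
          (𝓝 (∫ s : ℝ, ∑' k : ℕ, cdfTerm α n x (k + 1) s)) ∧
        P.real {ω | squareSumRatio X ω - 1 / (n : ℝ) ≤ x} =
          cdfConst α n * ∫ s : ℝ, ∑' k : ℕ, cdfTerm α n x (k + 1) s) ∧
    -- the explicit formula for `α = 1`
    (α = 1 → 6 ≤ n → ∀ x : ℝ, 0 ≤ x → x ≤ 1 - 1 / (n : ℝ) →
      (∀ s : ℝ, Summable (fun k : ℕ => greenwoodTerm n x (k + 1) s)) ∧
      Integrable (fun s : ℝ => ∑' k : ℕ, greenwoodTerm n x (k + 1) s) ∧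
      P.real {ω | squareSumRatio X ω - 1 / (n : ℝ) ≤ x} =
        (n.factorial : ℝ) / (Real.pi ^ 2 * ((n : ℝ) / Real.exp 1) ^ n) *
          ∫ s : ℝ, ∑' k : ℕ, greenwoodTerm n x (k + 1) s) := by
  obtain ⟨hn3, hnα⟩ := max_lt_iff.1 hn
  have hn2 : 2 ≤ n := by
    have : (2 : ℝ) < n := by linarith
    exact_mod_cast this.le
  have hnα' : 1 < n * α := by
    have h1 : 1 / α * α = 1 := by field_simp
    nlinarith
  -- The decay exponent must be below 1 and at most α. The value 3/4 leaves room: nβ > 1 for n > 3,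
  -- and nβ > 3 for n ≥ 6.
  set β := min α (3 / 4) with hβdef
  have hβ0 : 0 < β := lt_min hα (by norm_num)
  have hβ1 : β < 1 := (min_le_right _ _).trans_lt (by norm_num)
  have hβα : β ≤ α := min_le_left _ _
  have hnβ : 1 < n * β := by
    rcases min_choice α (3 / 4) with h | h
    · rw [hβdef, h]; exact hnα'
    · rw [hβdef, h]; linarith
  have hint : ∀ t : ℝ, 0 < t → Integrable (fun s : ℝ => gammaPsi α s t ^ n) := fun t ht =>
    integrable_gammaPsi_pow hα hβ0 hβ1 hβα ht hnβ
  have hcdf : ∀ x : ℝ, 0 ≤ x → x ≤ 1 - 1 / (n : ℝ) → ∀ l : ℝ,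
      Tendsto (fun K : ℕ => ∫ s : ℝ, ∑ k ∈ Finset.Icc 1 K, cdfTerm α n x k s) atTop (𝓝 l) →
      P.real {ω | squareSumRatio X ω - 1 / (n : ℝ) ≤ x} = cdfConst α n * l := by
    intro x hx hx1 l hl
    rw [tendsto_nhds_unique hl (tendsto_integral_sum_cdfTerm hα hn2 hx hx1 hint), ← mul_assoc,
      cdfConst_mul_density hα (by omega), one_mul, measureReal_squareSumRatio_eq hlaw hindep]
  -- ⌊n/2⌋ > 2 forces n ≥ 6, which settles β = 3/4; ⌊n/2⌋ > 3/(2α) gives nα > 3, which settles β =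
  -- α.
  have hunder : max 2 (max (1 + 1 / (2 * α)) (3 / (2 * α))) < ((n / 2 : ℕ) : ℝ) → 3 < n * β := by
    intro hmax
    obtain ⟨h2, hmax'⟩ := max_lt_iff.1 hmax
    obtain ⟨-, h3⟩ := max_lt_iff.1 hmax'
    have h2' : 2 < n / 2 := by exact_mod_cast h2
    have h6 : (6 : ℝ) ≤ n := by exact_mod_cast (by omega : 6 ≤ n)
    have hhalf : ((n / 2 : ℕ) : ℝ) * 2 ≤ n := by exact_mod_cast Nat.div_mul_le_self n 2
    rw [div_lt_iff₀ (by positivity)] at h3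
    rcases min_choice α (3 / 4) with h | h
    · rw [hβdef, h]
      nlinarith
    · rw [hβdef, h]; linarith
  have hiii : max 2 (max (1 + 1 / (2 * α)) (3 / (2 * α))) < ((n / 2 : ℕ) : ℝ) →
      ∀ x : ℝ, 0 ≤ x → x ≤ 1 - 1 / (n : ℝ) →
        (∀ s : ℝ, Summable (fun k : ℕ => cdfTerm α n x (k + 1) s)) ∧
        Integrable (fun s : ℝ => ∑' k : ℕ, cdfTerm α n x (k + 1) s) ∧
        Tendsto (fun K : ℕ => ∫ s : ℝ, ∑ k ∈ Finset.Icc 1 K, cdfTerm α n x k s) atTop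
          (𝓝 (∫ s : ℝ, ∑' k : ℕ, cdfTerm α n x (k + 1) s)) ∧
        P.real {ω | squareSumRatio X ω - 1 / (n : ℝ) ≤ x} =
          cdfConst α n * ∫ s : ℝ, ∑' k : ℕ, cdfTerm α n x (k + 1) s := by
    intro hmax x hx hx1
    obtain ⟨h1, h2, h3⟩ :=
      tendsto_integral_sum_cdfTerm_tsum hα hβ0 hβ1 hβα hn2 (hunder hmax) x
    exact ⟨h1, h2, h3, hcdf x hx hx1 _ h3⟩
  refine ⟨fun i s t ht => ?_, fun x hx hx1 => ⟨fun K => ?_, ?_⟩, hiii, ?_⟩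
  · rw [← integral_gammaMeasure_cexp_eq_gammaPsi hα s ht, ← (hlaw i).map_eq,
      integral_map (hlaw i).aemeasurable (by fun_prop)]
  · exact integrable_finsetSum _ fun k hk =>
      integrable_cdfTerm hα hn2 (Finset.mem_Icc.1 hk).1 x hint
  · have h := tendsto_integral_sum_cdfTerm hα hn2 hx hx1 hint
    exact ⟨_, h, hcdf x hx hx1 _ h⟩
  · rintro rfl hn6 x hx hx1
    have hmax : max 2 (max (1 + 1 / (2 * 1)) (3 / (2 * 1))) < ((n / 2 : ℕ) : ℝ) := by
      have : (3 : ℝ) ≤ ((n / 2 : ℕ) : ℝ) := by exact_mod_cast (by omega : 3 ≤ n / 2)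
      refine max_lt (by linarith) (max_lt ?_ ?_) <;> norm_num <;> linarith
    obtain ⟨h1, h2, -, h4⟩ := hiii hmax x hx hx1
    simp_rw [greenwoodTerm_eq_cdfTerm hn2]
    refine ⟨h1, h2, ?_⟩
    rw [h4, cdfConst, one_mul, Real.Gamma_nat_eq_factorial, Real.rpow_natCast]
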